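/- Let $M$ be a finite-dimensional smooth manifold, let $f(u,q)$ be a smooth family of vector fields on $M$ and $L(u,q)$ a smooth function, $u\in\mathbb R^k$, $q\in M$, and let $0\le t_0<t_1\le T$. Let $\Omega$ be the Banach manifold of admissible pairs $\omega=(q(\cdot),u(\cdot))$ with $u\in L^\infty([0,T],\mathbb R^k)$, $q$ Lipschitz and $\dot q=f(u,q)$ almost everywhere on $[0,T]$. Write $F_t(\omega)=q(t)$ and $J_{t_0}^{t_1}(\omega)=\int_{t_0}^{t_1}L(u,q)\,dt$. For a map $F$ from a Banach manifold $\mathcal U$ to a finite-dimensional manifold $P$, a functional $J:\mathcal U\to\mathbb R$ and a number $\nu$, a pair $(\omega,\lambda)$ with $\lambda\in T^*_{F(\omega)}P$ is a Lagrange point of $(F,J)$ if $\langle\lambda,dF[\omega](w)\rangle-\nu\,dJ[\omega](w)=0$ for all $w\in T_\omega\mathcal U$. In local coordinates put $Q(v,w)=\langle\lambda,d^2F[\omega](v,w)\rangle-\nu\,d^2J[\omega](v,w)$. For a finite-dimensional $W\subset T_\omega\mathcal U$, the $\mathcal L$-derivative $\mathcal L(F,\nu J)[\omega,\lambda](W)\subset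 T_\lambda(T^*P)$ is the set of vectors $(\xi,dF[\omega](v))$, in canonical coordinates, with $v\in W$ and $\langle\xi,dF[\omega](w)\rangle+Q(v,w)=0$ for all $w\in W$. For an arbitrary subspace $V$, $\mathcal L(F,\nu J)[\omega,\lambda](V)$ is the limit in the Grassmannian, when it exists, of $\mathcal L(F,\nu J)[\omega,\lambda](W)$ over the finite-dimensional subspaces $W\subset V$ directed by inclusion; if $V=T_\omega\mathcal U$, it is omitted from the notation. Let $\nu\in\mathbb R$ (in applications $\nu\in\{0,1\}$), let $N_0\subset M$ be an embedded submanifold, let $\omega\in F_{t_0}^{-1}(N_0)$, $q_0=F_{t_0}(\omega)$, and let $(\omega,(-\lambda(t_0),\lambda(t_1)))$ be a Lagrange point of $((F_{t_0},F_{t_1}),J_{t_0}^{t_1})$, where $(F_{t_0},F_{t_1}):\Omega\to M\times M$. Let $\pi_0,\pi_1$ be the projections of $T_{-\lambda(t_0)}(T^*M)\times T_{\lambda(t_1)}(T^*M)$ to its two factors. Suppose that $\lambda(t_0)$ annihilates $T_{q_0}N_0$. Then: 1. $(\omega,\lambda(t_1))$ is a Lagrange point of the problem with initial point in $N_0$,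 that is, of the restriction of $(F_{t_1},J_{t_0}^{t_1})$ to $F_{t_0}^{-1}(N_0)$: $$\langle\lambda(t_1),dF_{t_1}[\omega](w)\rangle-\nu\,dJ_{t_0}^{t_1}[\omega](w)=0\qquad\text{for all } w\in T_\omega F_{t_0}^{-1}(N_0).$$ 2. If the $\mathcal L$-derivative $\mathcal L(F_{t_0},F_{t_1},\nu J_{t_0}^{t_1})[\omega,(-\lambda(t_0),\lambda(t_1))]$ exists, then so does that of the problem with initial point in $N_0$, and $$\mathcal L(F_{t_1},\nu J_{t_0}^{t_1})[\omega,\lambda(t_1)]\bigl(T_\omega F_{t_0}^{-1}(N_0)\bigr)=\pi_1\Bigl(\mathcal L(F_{t_0},F_{t_1},\nu J_{t_0}^{t_1})[\omega,(-\lambda(t_0),\lambda(t_1))]\cap\pi_0^{-1}\bigl(T_{q_0}^\perp N_0\times T_{q_0}N_0\bigr)\Bigr).$$ Here $T_{q_0}^\perp N_0\subset T^*_{q_0}M$ is the annihilator of $T_{q_0}N_0$, and $T_{q_0}^\perp N_0\times T_{q_0}N_0$ is regarded as a subspace of $T_{-\lambda(t_0)}(T^*M)$ by means of the canonical coordinates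 of $T^*M$ induced by a chart of $M$ around $q_0$ in which $N_0$ is an open piece of an affine subspace; on $\Omega$ one uses the coordinates $(q(t_0),u)$, with $q(t_0)$ written in that chart, so that $F_{t_0}^{-1}(N_0)$ is also an open piece of an affine subspace. -/

import Mathlib

open Set Filter Topology MeasureTheory
open scoped Manifold ContDiff ENNReal NNReal

namespace LDeriv

noncomputable section

/-! ### Limits in the Grassmannian -/

/-- The neighbourhood filter of `Λ` in the Grassmannian of the finite-dimensional space `G`.
The Grassmannian is the quotient of the space of injective linear maps `Λ → G` by `GL(Λ)`; the
quotient map `T ↦ range T` is open, so the neighbourhoods of `Λ` are the images of the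
neighbourhoods of the inclusion of `Λ`. -/
def grassmannNhds {G : Type*} [NormedAddCommGroup G] [NormedSpace ℝ G] (Λ : Submodule ℝ G) :
    Filter (Submodule ℝ G) :=
  Filter.map (fun T : Λ →L[ℝ] G => LinearMap.range (T : Λ →ₗ[ℝ] G)) (𝓝 Λ.subtypeL)

/-- The finite-dimensional subspaces of `V`, directed by inclusion. -/
abbrev FinDimSub {X : Type*} [AddCommGroup X] [Module ℝ X] (V : Submodule ℝ X) : Type _ :=
  {W : Submodule ℝ X // W ≤ V ∧ FiniteDimensional ℝ W}

/-! ### First and second differentials, Lagrange points, `𝓛`-derivatives -/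

section General

variable {X : Type*} [NormedAddCommGroup X] [NormedSpace ℝ X]
variable {B : Type*} [NormedAddCommGroup B] [NormedSpace ℝ B]
variable {B' : Type*} [NormedAddCommGroup B'] [NormedSpace ℝ B']

/-- The second differential of `g` at `x`, as the symmetric bilinear map whose quadratic map is
`v ↦ d²g[x](v, v)`. For a map `g` of class `C²` near `x` the two summands are equal. -/
def secondDiff (g : X → B) (x : X) : X →L[ℝ] X →L[ℝ] B :=
  (1 / 2 : ℝ) • (fderiv ℝ (fderiv ℝ g) x + (fderiv ℝ (fderiv ℝ g) x).flip)

variable (X B) in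
/-- The first and second differentials at a point, in local coordinates, of a constrained
variational problem `(F, J)`, where `F` takes values in a manifold modelled on `B`
and `J` is the functional. -/
structure TwoJet where
  dF : X →L[ℝ] B
  ddF : X →L[ℝ] X →L[ℝ] B
  dJ : X →L[ℝ] ℝ
  ddJ : X →L[ℝ] X →L[ℝ] ℝ

/-- The differentials at `x` of the problem `(g, j)`. -/
def TwoJet.of (g : X → B) (j : X → ℝ) (x : X) : TwoJet X B where
  dF := fderiv ℝ g x
  ddF := secondDiff g x
  dJ := fderiv ℝ j x
  ddJ := secondDiff j x

/-- The differentials at `x` of the problem `((g₀, g₁), j)`; those of the map `(g₀, g₁)`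
are taken componentwise. -/
def TwoJet.ofPair (g₀ : X → B) (g₁ : X → B') (j : X → ℝ) (x : X) : TwoJet X (B × B') where
  dF := (fderiv ℝ g₀ x).prod (fderiv ℝ g₁ x)
  ddF :=
    ((ContinuousLinearMap.compL ℝ X B (B × B')) (ContinuousLinearMap.inl ℝ B B')).comp
        (secondDiff g₀ x) +
      ((ContinuousLinearMap.compL ℝ X B' (B × B')) (ContinuousLinearMap.inr ℝ B B')).comp
        (secondDiff g₁ x)
  dJ := fderiv ℝ j x
  ddJ := secondDiff j x

/-- The Lagrange multiplier rule `⟨p, dF w⟩ - ν dJ w = 0` for all variations `w ∈ V`. -/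
def IsLagrangePoint (j : TwoJet X B) (p : StrongDual ℝ B) (ν : ℝ) (V : Submodule ℝ X) : Prop :=
  ∀ w ∈ V, p (j.dF w) - ν * j.dJ w = 0

/-- The form `Q(v, w) = ⟨p, d²F(v, w)⟩ - ν d²J(v, w)`. -/
def secondVariation (j : TwoJet X B) (p : StrongDual ℝ B) (ν : ℝ) (v w : X) : ℝ :=
  p (j.ddF v w) - ν * j.ddJ v w

/-- The `𝓛`-derivative over a finite-dimensional space of variations `W`: the vectors
`(ξ, dF v)` with `v ∈ W` and `⟨ξ, dF w⟩ + Q(v, w) = 0` for all `w ∈ W`. The tangent space at a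
covector of the cotangent bundle is written as `B* × B` by the canonical coordinates. -/
def lDerivOver (j : TwoJet X B) (p : StrongDual ℝ B) (ν : ℝ) (W : Submodule ℝ X) :
    Submodule ℝ (StrongDual ℝ B × B) where
  carrier := {z | ∃ v ∈ W, z.2 = j.dF v ∧
    ∀ w ∈ W, z.1 (j.dF w) + secondVariation j p ν v w = 0}
  zero_mem' := ⟨0, W.zero_mem, by simp, fun w _ => by simp [secondVariation]⟩
  add_mem' := by
    rintro a b ⟨v, hv, hav, ha⟩ ⟨v', hv', hbv, hb⟩
    refine ⟨v + v', W.add_mem hv hv', by simp [hav, hbv], fun w hw => ?_⟩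
    have h1 := ha w hw
    have h2 := hb w hw
    simp only [secondVariation, map_add, add_apply, Prod.fst_add] at *
    linarith
  smul_mem' := by
    rintro c a ⟨v, hv, hav, ha⟩
    refine ⟨c • v, W.smul_mem c hv, by simp [hav], fun w hw => ?_⟩
    have h1 := ha w hw
    simp only [secondVariation, map_smul, smul_apply, Prod.smul_fst,
      smul_eq_mul] at *
    linear_combination c * h1

/-- `Λ` is the `𝓛`-derivative over an arbitrary space of variations `V`: the limit in the
Grassmannian of the `𝓛`-derivatives over the increasing finite-dimensional subspaces of `V`. -/
def IsLDerivative (j : TwoJet X B) (p : StrongDual ℝ B) (ν : ℝ) (V : Submodule ℝ X)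
    (Λ : Submodule ℝ (StrongDual ℝ B × B)) : Prop :=
  Tendsto (fun W : FinDimSub V => lDerivOver j p ν W.1) atTop (grassmannNhds Λ)

/-- The projection `π₀ : T(T*(M × M')) → T(T*M)` in canonical coordinates. -/
def proj₀ : (StrongDual ℝ (B × B') × (B × B')) →ₗ[ℝ] (StrongDual ℝ B × B) where
  toFun z := (z.1.comp (ContinuousLinearMap.inl ℝ B B'), z.2.1)
  map_add' _ _ := rfl
  map_smul' _ _ := rfl

/-- The projection `π₁ : T(T*(M × M')) → T(T*M')` in canonical coordinates. -/
def proj₁ : (StrongDual ℝ (B × B') × (B × B')) →ₗ[ℝ] (StrongDual ℝ B' × B') where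
  toFun z := (z.1.comp (ContinuousLinearMap.inr ℝ B B'), z.2.2)
  map_add' _ _ := rfl
  map_smul' _ _ := rfl

/-- The plane `S^⊥ × S`. -/
def annihilatorProd (S : Submodule ℝ B) : Submodule ℝ (StrongDual ℝ B × B) where
  carrier := {z | (∀ s ∈ S, z.1 s = 0) ∧ z.2 ∈ S}
  zero_mem' := ⟨fun _ _ => rfl, S.zero_mem⟩
  add_mem' := fun ha hb =>
    ⟨fun s hs => by simp [ha.1 s hs, hb.1 s hs], S.add_mem ha.2 hb.2⟩
  smul_mem' := fun c _ ha => ⟨fun s hs => by simp [ha.1 s hs], S.smul_mem c ha.2⟩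

end General

/-! ### Charts, submanifolds and covectors -/

section Manifold

variable {E : Type*} [NormedAddCommGroup E] [NormedSpace ℝ E]
variable {M : Type*} [TopologicalSpace M] [ChartedSpace E M]

/-- `N₀` is an embedded submanifold of `M` near its point `q`, and `φ` is a smooth slice chart
around `q`: in the domain of `φ`, the set `N₀` is the affine subspace `φ q + S`. -/
structure IsSliceChart (N₀ : Set M) (φ : OpenPartialHomeomorph M E) (q : M)
    (S : Submodule ℝ E) : Prop where
  smooth : φ ∈ IsManifold.maximalAtlas 𝓘(ℝ, E) ∞ M
  mem_source : q ∈ φ.source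
  mem_set : q ∈ N₀
  mem_iff : ∀ y ∈ φ.source, y ∈ N₀ ↔ φ y - φ q ∈ S

/-- `N₀` is an embedded submanifold of `M`. -/
def IsEmbeddedSubmanifold (N₀ : Set M) : Prop :=
  ∀ q ∈ N₀, ∃ (φ : OpenPartialHomeomorph M E) (S : Submodule ℝ E), IsSliceChart N₀ φ q S

/-- The coordinate frame of the chart `φ` at `q`: the differential of `φ⁻¹` at `φ q`. -/
def chartFrame (φ : OpenPartialHomeomorph M E) (q : M) : E →L[ℝ] TangentSpace 𝓘(ℝ, E) q :=
  mfderiv 𝓘(ℝ, E) 𝓘(ℝ, E) φ.symm (φ q)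

/-- The tangent space at `q` of a submanifold with slice chart `φ` and slice direction `S`. -/
def sliceTangentSpace (φ : OpenPartialHomeomorph M E) (q : M) (S : Submodule ℝ E) :
    Submodule ℝ (TangentSpace 𝓘(ℝ, E) q) :=
  S.map (chartFrame φ q : E →ₗ[ℝ] TangentSpace 𝓘(ℝ, E) q)

/-- The coordinates in the chart `φ` of a covector at `q`. -/
def covectorCoord (φ : OpenPartialHomeomorph M E) (q : M)
    (l : TangentSpace 𝓘(ℝ, E) q →L[ℝ] ℝ) : StrongDual ℝ E :=
  l.comp (chartFrame φ q)

end Manifold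

/-! ### Control systems -/

/-- Essentially bounded controls `[0, T] → ℝᵏ`. -/
abbrev Control (k : ℕ) (T : ℝ) : Type :=
  Lp (EuclideanSpace ℝ (Fin k)) ∞ (volume.restrict (Icc (0 : ℝ) T))

/-- The control system `q' = f(u, q)` with controls in `ℝᵏ` and the integrand `L(u, q)` of the
functional, both smooth in `(u, q)`. -/
structure ControlSystem (k : ℕ) (E : Type*) [NormedAddCommGroup E] [NormedSpace ℝ E]
    (M : Type*) [TopologicalSpace M] [ChartedSpace E M] [IsManifold 𝓘(ℝ, E) ∞ M] where
  f : EuclideanSpace ℝ (Fin k) → (q : M) → TangentSpace 𝓘(ℝ, E) q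
  L : EuclideanSpace ℝ (Fin k) → M → ℝ
  smooth_f : ContMDiff (𝓘(ℝ, EuclideanSpace ℝ (Fin k)).prod 𝓘(ℝ, E)) 𝓘(ℝ, E).tangent ∞
    (fun z : EuclideanSpace ℝ (Fin k) × M => (⟨z.2, f z.1 z.2⟩ : TangentBundle 𝓘(ℝ, E) M))
  smooth_L : ContMDiff (𝓘(ℝ, EuclideanSpace ℝ (Fin k)).prod 𝓘(ℝ, E)) 𝓘(ℝ, ℝ) ∞
    (fun z : EuclideanSpace ℝ (Fin k) × M => L z.1 z.2)

namespace ControlSystem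

variable {k : ℕ} {E : Type*} [NormedAddCommGroup E] [NormedSpace ℝ E]
variable {M : Type*} [TopologicalSpace M] [ChartedSpace E M] [IsManifold 𝓘(ℝ, E) ∞ M]

/-- `(q, u)` is an admissible pair on `[0, T]`: `q` is a (locally, in charts) Lipschitz curve on
`[0, T]` with `q'(t) = f(u(t), q(t))` for almost every `t`. -/
structure IsAdmissible (𝒮 : ControlSystem k E M) (T : ℝ) (q : ℝ → M) (u : Control k T) :
    Prop where
  continuousOn : ContinuousOn q (Icc 0 T)
  lipschitz : ∀ s ∈ Icc (0 : ℝ) T, ∃ C : ℝ≥0, ∃ O ∈ 𝓝[Icc (0 : ℝ) T] s,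
    MapsTo q O (chartAt E (q s)).source ∧ LipschitzOnWith C (fun t => chartAt E (q s) (q t)) O
  ode : ∀ᵐ t ∂(volume.restrict (Icc (0 : ℝ) T)),
    HasMFDerivWithinAt 𝓘(ℝ, ℝ) 𝓘(ℝ, E) q (Icc 0 T) t
      ((1 : ℝ →L[ℝ] ℝ).smulRight (𝒮.f (u t) (q t)))

open Classical in
/-- The trajectory on `[0, T]` with control `u` that passes through `a` at the time `t₀`
(the constant curve `a` if there is none). -/
def trajectory (𝒮 : ControlSystem k E M) (T t₀ : ℝ) (a : M) (u : Control k T) : ℝ → M :=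
  if h : ∃ q : ℝ → M, 𝒮.IsAdmissible T q u ∧ q t₀ = a then h.choose else fun _ => a

/-- The evaluation map `F_t` on the Banach manifold of admissible pairs, in local coordinates.
An admissible pair `(q, u)` near the given one has the coordinates `(x, u)`, where `x = φ₀(q(t₀))`,
and the values `q(t)` are written in the chart `φ`. -/
def evalCoord (𝒮 : ControlSystem k E M) (T t₀ : ℝ) (φ₀ φ : OpenPartialHomeomorph M E) (t : ℝ)
    (z : E × Control k T) : E :=
  φ (𝒮.trajectory T t₀ (φ₀.symm z.1) z.2 t)

/-- The functional `J_{t₀}^{t₁}(q, u) = ∫_{t₀}^{t₁} L(u, q) dt` in the same coordinates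
`(φ₀(q(t₀)), u)` on the manifold of admissible pairs. -/
def costCoord (𝒮 : ControlSystem k E M) (T t₀ t₁ : ℝ) (φ₀ : OpenPartialHomeomorph M E)
    (z : E × Control k T) : ℝ :=
  ∫ t in t₀..t₁, 𝒮.L (z.2 t) (𝒮.trajectory T t₀ (φ₀.symm z.1) z.2 t)

/-- The differentials of `(F_{t₀}, F_{t₁}, J_{t₀}^{t₁})` at the admissible pair `(q, u)`. -/
def twoPointJet (𝒮 : ControlSystem k E M) (T t₀ t₁ : ℝ) (φ₀ φ₁ : OpenPartialHomeomorph M E)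
    (q : ℝ → M) (u : Control k T) : TwoJet (E × Control k T) (E × E) :=
  TwoJet.ofPair (𝒮.evalCoord T t₀ φ₀ φ₀ t₀) (𝒮.evalCoord T t₀ φ₀ φ₁ t₁)
    (𝒮.costCoord T t₀ t₁ φ₀) (φ₀ (q t₀), u)

/-- The differentials of `(F_{t₁}, J_{t₀}^{t₁})` at the admissible pair `(q, u)`. -/
def endPointJet (𝒮 : ControlSystem k E M) (T t₀ t₁ : ℝ) (φ₀ φ₁ : OpenPartialHomeomorph M E)
    (q : ℝ → M) (u : Control k T) : TwoJet (E × Control k T) E :=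
  TwoJet.of (𝒮.evalCoord T t₀ φ₀ φ₁ t₁) (𝒮.costCoord T t₀ t₁ φ₀) (φ₀ (q t₀), u)

/-- The tangent space at `(q, u)` of `F_{t₀}⁻¹(N₀)`, that is `(dF_{t₀})⁻¹(T N₀)`, where `φ₀` is a
slice chart for `N₀` with direction `S`. In the coordinates `(φ₀(q(t₀)), u)` the submanifold
`F_{t₀}⁻¹(N₀)` is itself an affine subspace with this direction, so the second differential of
the restriction of a map to it is the restriction of the second differential. -/
def startTangentSpace (𝒮 : ControlSystem k E M) (T t₀ : ℝ) (φ₀ : OpenPartialHomeomorph M E)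
    (q : ℝ → M) (u : Control k T) (S : Submodule ℝ E) : Submodule ℝ (E × Control k T) :=
  S.comap (fderiv ℝ (𝒮.evalCoord T t₀ φ₀ φ₀ t₀) (φ₀ (q t₀), u) : E × Control k T →ₗ[ℝ] E)

end ControlSystem

end

end LDeriv

/-!
In the coordinates `(q(t₀), u)` the map `F_{t₀}` is a linear projection `A₀`, so its second
differential vanishes and the second variations of the problems with free and with restricted
initial point are the same form `Q`, considered on the whole space `X` and on `V = A₀⁻¹(S)`.

The planes over finite-dimensional subspaces are Lagrangian, and so is their limit `Λ`. The
reduction of a Lagrangian plane is Lagrangian, hence has the dimension of the planes of the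
restricted problem. It is therefore enough that every vector of the reduction of `Λ` is a limit of
vectors of these planes.

If `Q` or `-Q` has finite index on `V`, subtract from `Q` twice its part on a maximal definite
subspace. This gives a seminorm `g` that dominates `Q`, and for a vector `(ξ, A r)` with
`ξ ∘ A + Q(r, ·)` small with respect to `g` there are vectors of the planes nearby. A vector of
`Λ` provides such approximate vectors on `V`, because the component of its variations along a
complement of `V` is controlled by finitely many extra coordinates `Q(·, κ x)`.

If both indices are infinite, every value `Q(z, z)` is attained on each subspace of finite
codimension, so that new directions perturb the planes at will. Convergence then forces `Λ` to
lie in the plane over the whole space, and an exact solution `v ∈ V` solves the restricted problem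
over all large subspaces.
-/

namespace LDeriv

open Module

noncomputable section

/-! ### The canonical symplectic form -/

section Symplectic

variable {B : Type*} [NormedAddCommGroup B] [NormedSpace ℝ B]

variable (B) in
/-- The canonical symplectic form of the cotangent space `B* × B`. A subspace `Λ` of `B* × B` is
isotropic if `Λ ≤ (sympForm B).orthogonal Λ`, coisotropic if `(sympForm B).orthogonal Λ ≤ Λ` and
Lagrangian if both hold. -/
def sympForm : LinearMap.BilinForm ℝ (StrongDual ℝ B × B) :=
  LinearMap.mk₂ ℝ (fun z z' => z.1 z'.2 - z'.1 z.2)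
    (fun a b c => by simp; ring) (fun c a b => by simp; ring)
    (fun a b c => by simp; ring) (fun c a b => by simp; ring)

@[simp] theorem sympForm_apply (z z' : StrongDual ℝ B × B) :
    sympForm B z z' = z.1 z'.2 - z'.1 z.2 := rfl

theorem sympForm_isAlt : (sympForm B).IsAlt := fun z => by simp

theorem sympForm_nondegenerate : (sympForm B).Nondegenerate := by
  have separating : ∀ z : StrongDual ℝ B × B, (∀ z', sympForm B z z' = 0) → z = 0 := by
    intro z hz
    have fst_eq : z.1 = 0 := by
      ext x
      simpa using hz (0, x)
    have snd_eq : z.2 = 0 := by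
      by_contra hne
      obtain ⟨g, hg⟩ := SeparatingDual.exists_ne_zero (R := ℝ) hne
      exact hg (by simpa using hz (g, 0))
    exact Prod.ext fst_eq snd_eq
  exact ⟨separating, fun z hz => separating z fun z' => sympForm_isAlt.isRefl _ _ (hz z')⟩

theorem continuous_sympForm {Y : Type*} [TopologicalSpace Y] {f g : Y → StrongDual ℝ B × B}
    (hf : Continuous f) (hg : Continuous g) : Continuous fun y => sympForm B (f y) (g y) :=
  (hf.fst.clm_apply hg.snd).sub (hg.fst.clm_apply hf.snd)

variable [FiniteDimensional ℝ B]

theorem finrank_strongDual : finrank ℝ (StrongDual ℝ B) = finrank ℝ B :=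
  (LinearMap.toContinuousLinearMap (𝕜 := ℝ) (E := B) (F' := ℝ)).finrank_eq.symm.trans
    Subspace.dual_finrank_eq

theorem finrank_orthogonal_sympForm (Λ : Submodule ℝ (StrongDual ℝ B × B)) :
    finrank ℝ ((sympForm B).orthogonal Λ) = finrank ℝ B + finrank ℝ B - finrank ℝ Λ := by
  rw [LinearMap.BilinForm.finrank_orthogonal sympForm_nondegenerate, finrank_prod,
    finrank_strongDual]

theorem orthogonal_orthogonal_sympForm (Λ : Submodule ℝ (StrongDual ℝ B × B)) :
    (sympForm B).orthogonal ((sympForm B).orthogonal Λ) = Λ :=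
  LinearMap.BilinForm.orthogonal_orthogonal sympForm_nondegenerate sympForm_isAlt.isRefl Λ

theorem orthogonal_inf_sympForm (Λ Λ' : Submodule ℝ (StrongDual ℝ B × B)) :
    (sympForm B).orthogonal (Λ ⊓ Λ') = (sympForm B).orthogonal Λ ⊔ (sympForm B).orthogonal Λ' := by
  refine le_antisymm ?_ (sup_le (LinearMap.BilinForm.orthogonal_le inf_le_left)
    (LinearMap.BilinForm.orthogonal_le inf_le_right))
  rw [← orthogonal_orthogonal_sympForm (_ ⊔ _)]
  refine LinearMap.BilinForm.orthogonal_le (le_inf ?_ ?_)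
  · exact (LinearMap.BilinForm.orthogonal_le le_sup_left).trans_eq
      (orthogonal_orthogonal_sympForm Λ)
  · exact (LinearMap.BilinForm.orthogonal_le le_sup_right).trans_eq
      (orthogonal_orthogonal_sympForm Λ')

theorem finrank_le_of_isotropic {Λ : Submodule ℝ (StrongDual ℝ B × B)}
    (h : Λ ≤ (sympForm B).orthogonal Λ) : finrank ℝ Λ ≤ finrank ℝ B := by
  have := Submodule.finrank_mono h
  have := finrank_orthogonal_sympForm Λ
  omega

theorem le_finrank_of_coisotropic {Λ : Submodule ℝ (StrongDual ℝ B × B)}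
    (h : (sympForm B).orthogonal Λ ≤ Λ) : finrank ℝ B ≤ finrank ℝ Λ := by
  have := Submodule.finrank_mono h
  have := finrank_orthogonal_sympForm Λ
  omega

theorem orthogonal_eq_of_isotropic {Λ : Submodule ℝ (StrongDual ℝ B × B)}
    (h : Λ ≤ (sympForm B).orthogonal Λ) (hd : finrank ℝ B ≤ finrank ℝ Λ) :
    (sympForm B).orthogonal Λ = Λ := by
  have := finrank_orthogonal_sympForm Λ
  exact (Submodule.eq_of_le_of_finrank_le h (by omega)).symm

theorem exists_norm_le_sympForm_eq (g : StrongDual ℝ (StrongDual ℝ B × B)) :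
    ∃ y : StrongDual ℝ B × B, ‖y‖ ≤ ‖g‖ ∧ ∀ z, sympForm B z y = g z := by
  set y := -((sympForm B).toDual sympForm_nondegenerate).symm g.toLinearMap
  have hy : ∀ z, sympForm B z y = g z := fun z => by
    rw [map_neg, sympForm_isAlt.neg_eq, LinearMap.BilinForm.apply_toDual_symm_apply]
    rfl
  refine ⟨y, max_le ?_ ?_, hy⟩
  · refine y.1.opNorm_le_bound (norm_nonneg g) fun x => ?_
    simpa [← hy] using g.le_opNorm (0, x)
  · refine NormedSpace.norm_le_dual_bound ℝ y.2 (norm_nonneg g) fun ξ => ?_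
    simpa [← hy] using g.le_opNorm (ξ, 0)

/-- The functional `σ(·, z)` on `Λ` is extended by Hahn–Banach and represented by a vector `y`
of norm at most `ε`; then `z - y` is orthogonal to `Λ`. -/
theorem exists_near_of_abs_sympForm_le {Λ : Submodule ℝ (StrongDual ℝ B × B)}
    (h : (sympForm B).orthogonal Λ ≤ Λ) {z : StrongDual ℝ B × B} {ε : ℝ} (hε : 0 ≤ ε)
    (hz : ∀ z' ∈ Λ, |sympForm B z' z| ≤ ε * ‖z'‖) : ∃ z' ∈ Λ, ‖z - z'‖ ≤ ε := by
  let f : StrongDual ℝ Λ :=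
    ((sympForm B).flip z ∘ₗ Λ.subtype).mkContinuous ε fun z' : Λ => hz z' z'.2
  obtain ⟨g, hgf, hgn⟩ := exists_extension_norm_eq Λ f
  obtain ⟨y, hyn, hy⟩ := exists_norm_le_sympForm_eq g
  refine ⟨z - y, h fun z' hz' => ?_, ?_⟩
  · have : g z' = sympForm B z' z := hgf ⟨z', hz'⟩
    change sympForm B z' (z - y) = 0
    rw [map_sub, hy, this, sub_self]
  · rw [sub_sub_cancel]
    exact hyn.trans (hgn.trans_le (LinearMap.mkContinuous_norm_le _ hε _))

end Symplectic

/-! ### Convergence in the Grassmannian -/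

section Grassmann

variable {G : Type*} [NormedAddCommGroup G] [NormedSpace ℝ G]
variable {ι : Type*} {l : Filter ι} {F : ι → Submodule ℝ G} {Λ : Submodule ℝ G} {z : G}

/-- `z` is a limit of vectors of the subspaces `F i` along `l`, that is, it lies in the lower
Kuratowski limit of the `F i`. -/
def IsLimitVector (F : ι → Submodule ℝ G) (l : Filter ι) (z : G) : Prop :=
  ∀ O ∈ 𝓝 z, ∀ᶠ i in l, ∃ z' ∈ F i, z' ∈ O

theorem isLimitVector_iff_norm_sub_le :
    IsLimitVector F l z ↔ ∀ ε > 0, ∀ᶠ i in l, ∃ z' ∈ F i, ‖z - z'‖ ≤ ε := by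
  refine ⟨fun h ε hε => ?_, fun h O hO => ?_⟩
  · filter_upwards [h _ (Metric.closedBall_mem_nhds z hε)] with i ⟨z', hz', hzz'⟩
    exact ⟨z', hz', (dist_eq_norm' z' z).symm.trans_le hzz'⟩
  · obtain ⟨ε, hε, hO⟩ := Metric.nhds_basis_closedBall.mem_iff.1 hO
    filter_upwards [h ε hε] with i ⟨z', hz', hzz'⟩
    exact ⟨z', hz', hO ((dist_eq_norm' z' z).trans_le hzz')⟩

theorem IsLimitVector.map {G' κ : Type*} [NormedAddCommGroup G'] [NormedSpace ℝ G']
    {F' : κ → Submodule ℝ G'} {l' : Filter κ} {Φ : G → G'} {m : κ → ι}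
    (h : IsLimitVector F l z) (hΦ : ContinuousAt Φ z) (hm : Tendsto m l' l)
    (hmaps : ∀ᶠ j in l', MapsTo Φ (F (m j)) (F' j)) : IsLimitVector F' l' (Φ z) := by
  intro O hO
  filter_upwards [hm.eventually (h _ (hΦ hO)), hmaps] with j ⟨z', hz', hzO⟩ hj
  exact ⟨Φ z', hj hz', hzO⟩

theorem IsLimitVector.mem_of_frequently_le {K : Submodule ℝ G} (h : IsLimitVector F l z)
    (hK : IsClosed (K : Set G)) (hF : ∃ᶠ i in l, F i ≤ K) : z ∈ K := by
  refine hK.closure_subset (mem_closure_iff_nhds.2 fun O hO => ?_)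
  obtain ⟨i, hi, z', hz', hzO⟩ := (hF.and_eventually (h O hO)).exists
  exact ⟨z', hzO, hi hz'⟩

theorem IsLimitVector.prodMk {z' : G} (h : IsLimitVector F l z) (h' : IsLimitVector F l z') :
    ∀ O ∈ 𝓝 (z, z'), ∀ᶠ i in l, ∃ y ∈ F i, ∃ y' ∈ F i, (y, y') ∈ O := by
  intro O hO
  obtain ⟨U, hU, U', hU', hUO⟩ := mem_nhds_prod_iff.1 hO
  filter_upwards [h U hU, h' U' hU'] with i ⟨y, hy, hyU⟩ ⟨y', hy', hyU'⟩
  exact ⟨y, hy, y', hy', hUO ⟨hyU, hyU'⟩⟩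

theorem eventually_exists_mem_nhds_of_isLimitVector {κ : Type*} [Finite κ] {z : κ → G}
    (h : ∀ j, IsLimitVector F l (z j)) :
    ∀ O ∈ 𝓝 z, ∀ᶠ i in l, ∃ z' ∈ O, ∀ j, z' j ∈ F i := by
  intro O hO
  rw [nhds_pi, Filter.mem_pi] at hO
  obtain ⟨I, -, U, hU, hUO⟩ := hO
  filter_upwards [eventually_all.2 fun j => h j (U j) (hU j)] with i hi
  choose z' hz' hzU using hi
  exact ⟨z', hUO fun j _ => hzU j, hz'⟩

theorem isLimitVector_of_tendsto_grassmannNhds (h : Tendsto F l (grassmannNhds Λ)) (hz : z ∈ Λ) :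
    IsLimitVector F l z := by
  intro O hO
  have heval : ContinuousAt (fun T : Λ →L[ℝ] G => T ⟨z, hz⟩) Λ.subtypeL :=
    (ContinuousLinearMap.apply ℝ G (⟨z, hz⟩ : Λ)).continuous.continuousAt
  filter_upwards [h (image_mem_map (heval hO))] with i ⟨T, hT, hTF⟩
  exact ⟨T ⟨z, hz⟩, hTF ▸ LinearMap.mem_range_self _ _, hT⟩

theorem eventually_infDist_le_of_tendsto_grassmannNhds (h : Tendsto F l (grassmannNhds Λ))
    {ε : ℝ} (hε : 0 < ε) : ∀ᶠ i in l, ∀ y ∈ F i, Metric.infDist y Λ ≤ ε * ‖y‖ := by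
  obtain ⟨δ, hδ, hδ₁, hδε⟩ : ∃ δ > 0, δ ≤ 1 / 2 ∧ 2 * δ ≤ ε :=
    ⟨min (1 / 2) (ε / 2), by positivity, min_le_left _ _,
      by linarith [min_le_right (1 / 2) (ε / 2)]⟩
  filter_upwards [h (image_mem_map (Metric.closedBall_mem_nhds Λ.subtypeL hδ))] with i ⟨T, hT, hTF⟩
  rw [← hTF]
  rintro _ ⟨z, rfl⟩
  have hTz : ‖T z - z‖ ≤ δ * ‖z‖ :=
    (T - Λ.subtypeL).le_of_opNorm_le ((dist_eq_norm T _).symm.trans_le hT) z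
  have hz : ‖z‖ ≤ 2 * ‖T z‖ := by
    have : ‖z‖ ≤ ‖T z‖ + ‖T z - z‖ := norm_le_norm_add_norm_sub (T z) (z : G)
    nlinarith [norm_nonneg z]
  calc Metric.infDist (T z) Λ ≤ ‖T z - z‖ := by
        rw [← dist_eq_norm]
        exact Metric.infDist_le_dist_of_mem z.2
    _ ≤ δ * (2 * ‖T z‖) := hTz.trans (by gcongr)
    _ ≤ ε * ‖T z‖ := by nlinarith [norm_nonneg (T z)]

variable [FiniteDimensional ℝ Λ]

theorem eventually_finrank_eq_of_tendsto_grassmannNhds (h : Tendsto F l (grassmannNhds Λ)) :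
    ∀ᶠ i in l, finrank ℝ (F i) = finrank ℝ Λ := by
  have hinj : {T : Λ →L[ℝ] G | Function.Injective T} ∈ 𝓝 Λ.subtypeL :=
    ContinuousLinearMap.isOpen_injective.mem_nhds Λ.subtype_injective
  filter_upwards [h (image_mem_map hinj)] with i ⟨T, hT, hTF⟩
  exact hTF ▸ LinearMap.finrank_range_of_inj hT

theorem tendsto_grassmannNhds [FiniteDimensional ℝ G]
    (hd : ∀ᶠ i in l, finrank ℝ (F i) ≤ finrank ℝ Λ) (hΛ : ∀ z ∈ Λ, IsLimitVector F l z) :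
    Tendsto F l (grassmannNhds Λ) := by
  intro O hO
  change ∀ᶠ i in l, F i ∈ O
  let b := finBasis ℝ Λ
  let Φ : (Fin (finrank ℝ Λ) → G) →ₗ[ℝ] (Λ →L[ℝ] G) :=
    LinearMap.toContinuousLinearMap.toLinearMap ∘ₗ (b.constr ℝ).toLinearMap
  have Φ_apply : ∀ z' j, Φ z' (b j) = z' j := fun z' j => b.constr_basis ℝ z' j
  have Φ_b : Φ (fun j => b j) = Λ.subtypeL := by
    ext y
    exact LinearMap.congr_fun (b.ext fun j => Φ_apply _ j :
      (Φ (fun j => b j)).toLinearMap = Λ.subtype) y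
  have range_le : ∀ z' i, (∀ j, z' j ∈ F i) → LinearMap.range (Φ z').toLinearMap ≤ F i := by
    intro z' i hz'
    rw [LinearMap.range_eq_map, ← b.span_eq, Submodule.map_span_le]
    rintro _ ⟨j, rfl⟩
    exact (Φ_apply z' j).symm ▸ hz' j
  have hinj : {T : Λ →L[ℝ] G | Function.Injective T} ∈ 𝓝 Λ.subtypeL :=
    ContinuousLinearMap.isOpen_injective.mem_nhds Λ.subtype_injective
  have hΦ := Φ.continuous_of_finiteDimensional.continuousAt
    (Φ_b.symm ▸ inter_mem (mem_map.1 hO) hinj)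
  filter_upwards [hd, eventually_exists_mem_nhds_of_isLimitVector (fun j => hΛ _ (b j).2) _ hΦ]
    with i hdi ⟨z', ⟨hz'O, hz'inj⟩, hz'F⟩
  have heq : LinearMap.range (Φ z').toLinearMap = F i :=
    Submodule.eq_of_le_of_finrank_le (range_le z' i hz'F)
      (by rwa [LinearMap.finrank_range_of_inj hz'inj])
  exact heq ▸ hz'O

/-- A continuous projection onto `Λ` is injective on a subspace whose unit vectors are close
enough to `Λ`. -/
theorem exists_finrank_le_of_infDist_le (Λ : Submodule ℝ G) [FiniteDimensional ℝ Λ] :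
    ∃ ε > 0, ∀ Y : Submodule ℝ G, (∀ y ∈ Y, Metric.infDist y Λ ≤ ε * ‖y‖) →
      finrank ℝ Y ≤ finrank ℝ Λ := by
  obtain ⟨P, hP⟩ := Submodule.ClosedComplemented.of_finiteDimensional Λ
  have norm_le : ∀ y, P y = 0 → ‖y‖ ≤ (1 + ‖P‖) * Metric.infDist y Λ := by
    intro y hy
    rw [← div_le_iff₀' (by positivity)]
    refine (Metric.le_infDist ⟨0, Λ.zero_mem⟩).2 fun {z} hz => ?_
    rw [div_le_iff₀' (by positivity), dist_eq_norm]
    have : ‖z‖ ≤ ‖P‖ * ‖y - z‖ := by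
      have := P.le_opNorm (y - z)
      rwa [map_sub, hy, hP ⟨z, hz⟩, zero_sub, norm_neg] at this
    linarith [norm_le_norm_sub_add y z]
  refine ⟨1 / (2 * (1 + ‖P‖)), by positivity, fun Y hY => ?_⟩
  refine LinearMap.finrank_le_finrank_of_injective (f := P.toLinearMap ∘ₗ Y.subtype)
    (LinearMap.ker_eq_bot.1 (LinearMap.ker_eq_bot'.2 fun y hy => ?_))
  have half : ‖(y : G)‖ ≤ ‖(y : G)‖ / 2 := calc
    ‖(y : G)‖ ≤ (1 + ‖P‖) * (1 / (2 * (1 + ‖P‖)) * ‖(y : G)‖) := by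
      refine (norm_le y hy).trans ?_
      gcongr
      exact hY y y.2
    _ = ‖(y : G)‖ / 2 := by field_simp
  exact Subtype.ext (norm_eq_zero.1 (by linarith [norm_nonneg (y : G)]))

end Grassmann

/-! ### Lagrange planes of a linear map and a quadratic form -/

section Plane

theorem exists_dual_comp_eq {Y Z : Type*} [AddCommGroup Y] [Module ℝ Y] [AddCommGroup Z]
    [Module ℝ Z] (T : Y →ₗ[ℝ] Z) (f : Dual ℝ Y) (hf : ∀ y, T y = 0 → f y = 0) :
    ∃ g : Dual ℝ Z, ∀ y, g (T y) = f y := by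
  obtain ⟨g, hg⟩ : f ∈ T.dualMap.range := by
    rw [LinearMap.range_dualMap_eq_dualAnnihilator_ker, Submodule.mem_dualAnnihilator]
    exact hf
  exact ⟨g, LinearMap.congr_fun hg⟩

variable {X : Type*} [AddCommGroup X] [Module ℝ X]
variable {B : Type*} [NormedAddCommGroup B] [NormedSpace ℝ B]

/-- The plane of all `(ξ, A v)` with `v ∈ W` and `ξ ∘ A + Q(v, ·) = 0` on `W`: the `𝓛`-derivative
over `W` of a problem with first differential `A` and second variation `Q`. -/
def lagrangePlane (A : X →ₗ[ℝ] B) (Q : LinearMap.BilinForm ℝ X) (W : Submodule ℝ X) :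
    Submodule ℝ (StrongDual ℝ B × B) where
  carrier := {z | ∃ v ∈ W, z.2 = A v ∧ ∀ w ∈ W, z.1 (A w) + Q v w = 0}
  zero_mem' := ⟨0, W.zero_mem, by simp, fun w _ => by simp⟩
  add_mem' := by
    rintro a b ⟨v, hv, hav, ha⟩ ⟨v', hv', hbv, hb⟩
    refine ⟨v + v', W.add_mem hv hv', by simp [hav, hbv], fun w hw => ?_⟩
    simp only [map_add, LinearMap.add_apply, Prod.fst_add, add_apply]
    linarith [ha w hw, hb w hw]
  smul_mem' := by
    rintro c a ⟨v, hv, hav, ha⟩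
    refine ⟨c • v, W.smul_mem c hv, by simp [hav], fun w hw => ?_⟩
    simp only [map_smul, LinearMap.smul_apply, Prod.smul_fst, smul_apply, smul_eq_mul]
    linear_combination c * ha w hw

variable {A : X →ₗ[ℝ] B} {Q : LinearMap.BilinForm ℝ X}

theorem exists_strongDual_comp_eq [FiniteDimensional ℝ B] (W : Submodule ℝ X) (f : Dual ℝ X)
    (hf : ∀ w ∈ W, A w = 0 → f w = 0) : ∃ η : StrongDual ℝ B, ∀ w ∈ W, η (A w) = f w := by
  obtain ⟨η, hη⟩ := exists_dual_comp_eq (A ∘ₗ W.subtype) (f ∘ₗ W.subtype) fun w => hf w w.2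
  exact ⟨LinearMap.toContinuousLinearMap η, fun w hw => hη ⟨w, hw⟩⟩

theorem lagrangePlane_le_orthogonal (hQ : Q.IsSymm) (W : Submodule ℝ X) :
    lagrangePlane A Q W ≤ (sympForm B).orthogonal (lagrangePlane A Q W) := by
  rintro z ⟨v, hv, hzv, hz⟩ z' ⟨v', hv', hzv', hz'⟩
  change z'.1 z.2 - z.1 z'.2 = 0
  rw [hzv, hzv']
  linarith [hz v' hv', hz' v hv, hQ.eq v v']

/-- The plane over `W` is the image of the kernel of `T : (ξ, v) ↦ (ξ ∘ A + Q(v, ·))|_W`, so a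
vector `z` orthogonal to it gives a functional on `B* × W` which factors through `T`. The factor
is a functional on `W*`, hence a vector of `W`. -/
theorem orthogonal_lagrangePlane_le (hQ : Q.IsSymm) (W : Submodule ℝ X) [FiniteDimensional ℝ W] :
    (sympForm B).orthogonal (lagrangePlane A Q W) ≤ lagrangePlane A Q W := by
  intro z hz
  let T : (StrongDual ℝ B × W) →ₗ[ℝ] Dual ℝ W := LinearMap.coprod
    ((A ∘ₗ W.subtype).dualMap ∘ₗ ContinuousLinearMap.coeLM ℝ)
    (W.subtype.dualMap ∘ₗ Q ∘ₗ W.subtype)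
  let f : Dual ℝ (StrongDual ℝ B × W) :=
    (sympForm B).flip z ∘ₗ LinearMap.id.prodMap (A ∘ₗ W.subtype)
  have hTf : ∀ a, T a = 0 → f a = 0 := fun a ha =>
    hz (a.1, A a.2) ⟨a.2, a.2.2, rfl, fun w hw => LinearMap.congr_fun ha ⟨w, hw⟩⟩
  obtain ⟨φ, hφ⟩ := exists_dual_comp_eq T f hTf
  obtain ⟨v, rfl⟩ := (evalEquiv ℝ W).surjective φ
  have hv : ∀ (ξ : StrongDual ℝ B) (w : W), ξ (A v) + Q w v = ξ z.2 - z.1 (A w) :=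
    fun ξ w => hφ (ξ, w)
  refine ⟨v, v.2, (SeparatingDual.eq_iff_forall_dual_eq (R := ℝ)).2 fun ξ => ?_, fun w hw => ?_⟩
  · simpa using (hv ξ 0).symm
  · have := hv 0 ⟨w, hw⟩
    simp only [zero_apply, zero_add, zero_sub] at this
    rw [hQ.eq, this, add_neg_cancel]

theorem finrank_lagrangePlane [FiniteDimensional ℝ B] (hQ : Q.IsSymm) (W : Submodule ℝ X)
    [FiniteDimensional ℝ W] : finrank ℝ (lagrangePlane A Q W) = finrank ℝ B :=
  le_antisymm (finrank_le_of_isotropic (lagrangePlane_le_orthogonal hQ W))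
    (le_finrank_of_coisotropic (orthogonal_lagrangePlane_le hQ W))

end Plane

section Limit

variable {B : Type*} [NormedAddCommGroup B] [NormedSpace ℝ B]
variable {ι : Type*} {l : Filter ι} [l.NeBot] {F : ι → Submodule ℝ (StrongDual ℝ B × B)}

theorem sympForm_eq_zero_of_isLimitVector (hF : ∀ i, F i ≤ (sympForm B).orthogonal (F i))
    {z z' : StrongDual ℝ B × B} (hz : IsLimitVector F l z) (hz' : IsLimitVector F l z') :
    sympForm B z z' = 0 := by
  by_contra hne
  have hO : {p : (StrongDual ℝ B × B) × _ | sympForm B p.1 p.2 ≠ 0} ∈ 𝓝 (z, z') :=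
    (continuous_sympForm continuous_fst continuous_snd).continuousAt.eventually_ne hne
  obtain ⟨i, y, hy, y', hy', hyy'⟩ := (hz.prodMk hz' _ hO).exists
  exact hyy' (hF i hy' y hy)

theorem orthogonal_eq_of_tendsto_grassmannNhds [FiniteDimensional ℝ B]
    {Λ : Submodule ℝ (StrongDual ℝ B × B)} (hF : ∀ i, (sympForm B).orthogonal (F i) = F i)
    (h : Tendsto F l (grassmannNhds Λ)) : (sympForm B).orthogonal Λ = Λ := by
  refine orthogonal_eq_of_isotropic (fun z hz z' hz' => ?_) ?_
  · exact sympForm_eq_zero_of_isLimitVector (fun i => (hF i).ge)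
      (isLimitVector_of_tendsto_grassmannNhds h hz') (isLimitVector_of_tendsto_grassmannNhds h hz)
  · obtain ⟨i, hi⟩ := (eventually_finrank_eq_of_tendsto_grassmannNhds h).exists
    exact (le_finrank_of_coisotropic (hF i).le).trans_eq hi

end Limit

/-! ### Symplectic reduction -/

section Reduction

variable {B : Type*} [NormedAddCommGroup B] [NormedSpace ℝ B]
variable {B' : Type*} [NormedAddCommGroup B'] [NormedSpace ℝ B']

@[simp] theorem proj₀_fst_apply (z : StrongDual ℝ (B × B') × (B × B')) (x : B) :
    (proj₀ z).1 x = z.1 (x, 0) := rfl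

@[simp] theorem proj₀_snd (z : StrongDual ℝ (B × B') × (B × B')) : (proj₀ z).2 = z.2.1 := rfl

@[simp] theorem proj₁_fst_apply (z : StrongDual ℝ (B × B') × (B × B')) (x : B') :
    (proj₁ z).1 x = z.1 (0, x) := rfl

@[simp] theorem proj₁_snd (z : StrongDual ℝ (B × B') × (B × B')) : (proj₁ z).2 = z.2.2 := rfl

@[simp] theorem proj₀_coprod (ξ : StrongDual ℝ B) (η : StrongDual ℝ B') (x : B × B') :
    proj₀ (ξ.coprod η, x) = (ξ, x.1) := by
  ext <;> simp

@[simp] theorem proj₁_coprod (ξ : StrongDual ℝ B) (η : StrongDual ℝ B') (x : B × B') :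
    proj₁ (ξ.coprod η, x) = (η, x.2) := by
  ext <;> simp

theorem coprod_proj₀_proj₁ (z : StrongDual ℝ (B × B') × (B × B')) :
    ((proj₀ z).1.coprod (proj₁ z).1, ((proj₀ z).2, (proj₁ z).2)) = z := by
  ext <;> simp

theorem sympForm_prod (a b : StrongDual ℝ (B × B') × (B × B')) :
    sympForm (B × B') a b =
      sympForm B (proj₀ a) (proj₀ b) + sympForm B' (proj₁ a) (proj₁ b) := by
  rw [← coprod_proj₀_proj₁ a, ← coprod_proj₀_proj₁ b]
  simp only [sympForm_apply, ContinuousLinearMap.coprod_apply, proj₀_coprod, proj₁_coprod]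
  ring

/-- The symplectic reduction of `Λ` by the coisotropic subspace
`(S^⊥ × S) × (B'* × B')` of `(B × B')* × (B × B')`. -/
def reduction (S : Submodule ℝ B) (Λ : Submodule ℝ (StrongDual ℝ (B × B') × (B × B'))) :
    Submodule ℝ (StrongDual ℝ B' × B') :=
  (Λ ⊓ (annihilatorProd S).comap proj₀).map proj₁

theorem mem_reduction {S : Submodule ℝ B} {Λ : Submodule ℝ (StrongDual ℝ (B × B') × (B × B'))}
    {z : StrongDual ℝ B' × B'} :
    z ∈ reduction S Λ ↔
      ∃ ξ : StrongDual ℝ B, ∃ x ∈ S, (∀ s ∈ S, ξ s = 0) ∧ (ξ.coprod z.1, (x, z.2)) ∈ Λ := by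
  constructor
  · rintro ⟨y, ⟨hy, hyS⟩, rfl⟩
    exact ⟨(proj₀ y).1, (proj₀ y).2, hyS.2, hyS.1, (coprod_proj₀_proj₁ y).symm ▸ hy⟩
  · rintro ⟨ξ, x, hx, hξ, h⟩
    refine ⟨_, ⟨h, Submodule.mem_comap.2 ?_⟩, proj₁_coprod _ _ _⟩
    rw [proj₀_coprod]
    exact ⟨hξ, hx⟩

theorem orthogonal_annihilatorProd_le [FiniteDimensional ℝ B] (S : Submodule ℝ B) :
    (sympForm B).orthogonal (annihilatorProd S) ≤ annihilatorProd S := by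
  intro z hz
  refine ⟨fun s hs => ?_, ?_⟩
  · have : (0 : StrongDual ℝ B) z.2 - z.1 s = 0 := hz (0, s) ⟨fun _ _ => rfl, hs⟩
    simpa using this
  · by_contra hne
    obtain ⟨f, hf, hfS⟩ := S.exists_dual_map_eq_bot_of_notMem hne inferInstance
    have hfS : ∀ s ∈ S, f s = 0 := fun s hs =>
      (Submodule.mem_bot ℝ).1 (hfS ▸ Submodule.mem_map_of_mem hs)
    have : f z.2 - z.1 0 = 0 := hz (LinearMap.toContinuousLinearMap f, 0) ⟨hfS, S.zero_mem⟩
    exact hf (by simpa using this)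

theorem orthogonal_comap_proj₀ {P : Submodule ℝ (StrongDual ℝ B × B)}
    {a : StrongDual ℝ (B × B') × (B × B')}
    (ha : a ∈ (sympForm (B × B')).orthogonal (P.comap proj₀)) :
    proj₀ a ∈ (sympForm B).orthogonal P ∧ proj₁ a = 0 := by
  have orth : ∀ b ∈ P, ∀ b', sympForm B b (proj₀ a) + sympForm B' b' (proj₁ a) = 0 := by
    intro b hb b'
    have h : sympForm (B × B') (b.1.coprod b'.1, (b.2, b'.2)) a = 0 :=
      ha _ (Submodule.mem_comap.2 (by rwa [proj₀_coprod]))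
    rwa [sympForm_prod, proj₀_coprod, proj₁_coprod] at h
  exact ⟨fun b hb => by simpa using orth b hb 0,
    sympForm_nondegenerate.2 _ fun b' => by simpa using orth 0 P.zero_mem b'⟩

theorem orthogonal_reduction_le [FiniteDimensional ℝ B] [FiniteDimensional ℝ B']
    (S : Submodule ℝ B) {Λ : Submodule ℝ (StrongDual ℝ (B × B') × (B × B'))}
    (hΛ : (sympForm (B × B')).orthogonal Λ ≤ Λ) :
    (sympForm B').orthogonal (reduction S Λ) ≤ reduction S Λ := by
  intro y hy
  let Y : StrongDual ℝ (B × B') × (B × B') := ((0 : StrongDual ℝ B).coprod y.1, (0, y.2))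
  have proj₀_Y : proj₀ Y = 0 := proj₀_coprod _ _ _
  have proj₁_Y : proj₁ Y = y := proj₁_coprod _ _ _
  have hY : Y ∈ (sympForm (B × B')).orthogonal (Λ ⊓ (annihilatorProd S).comap proj₀) := by
    intro a ha
    change sympForm (B × B') a Y = 0
    rw [sympForm_prod, proj₀_Y, proj₁_Y, map_zero, zero_add]
    exact hy _ (Submodule.mem_map_of_mem ha)
  rw [orthogonal_inf_sympForm] at hY
  obtain ⟨z, hz, a, ha, hza⟩ := Submodule.mem_sup.1 hY
  obtain ⟨ha₀, ha₁⟩ := orthogonal_comap_proj₀ ha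
  have hz₀ : proj₀ z = -proj₀ a := by
    rw [eq_neg_iff_add_eq_zero, ← map_add, hza, proj₀_Y]
  refine ⟨z, ⟨hΛ hz, Submodule.mem_comap.2 ?_⟩, ?_⟩
  · rw [hz₀]
    exact neg_mem (orthogonal_annihilatorProd_le S ha₀)
  · rw [← proj₁_Y, ← hza, map_add, ha₁, add_zero]

end Reduction

/-! ### Nets of Lagrange planes -/

section Net

variable {X : Type*} [AddCommGroup X] [Module ℝ X]

instance {V : Submodule ℝ X} : Nonempty (FinDimSub V) := ⟨⟨⊥, bot_le, inferInstance⟩⟩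

instance {V : Submodule ℝ X} : IsDirectedOrder (FinDimSub V) := ⟨fun W W' => by
  have := W.2.2
  have := W'.2.2
  exact ⟨⟨W.1 ⊔ W'.1, sup_le W.2.1 W'.2.1, inferInstance⟩, le_sup_left (a := W.1),
    le_sup_right (a := W.1)⟩⟩

variable {B : Type*} [NormedAddCommGroup B] [NormedSpace ℝ B]

/-- The net of Lagrange planes over the finite-dimensional subspaces of `V`. -/
def lagrangeNet (A : X →ₗ[ℝ] B) (Q : LinearMap.BilinForm ℝ X) (V : Submodule ℝ X)
    (W : FinDimSub V) : Submodule ℝ (StrongDual ℝ B × B) :=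
  lagrangePlane A Q W.1

variable {A : X →ₗ[ℝ] B} {Q : LinearMap.BilinForm ℝ X}

theorem isLimitVector_lagrangeNet_of_restrict {V : Submodule ℝ X} {z : StrongDual ℝ B × B}
    (h : IsLimitVector (lagrangeNet (A ∘ₗ V.subtype) (Q.restrict V) ⊤) atTop z) :
    IsLimitVector (lagrangeNet A Q V) atTop z := by
  let m : FinDimSub V → FinDimSub (⊤ : Submodule ℝ V) := fun W =>
    ⟨W.1.submoduleOf V, le_top,
      have := W.2.2
      (Submodule.submoduleOfEquivOfLe W.2.1).symm.finiteDimensional⟩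
  have tendsto_m : Tendsto m atTop atTop := by
    refine tendsto_atTop_atTop.2 fun W₀ => ?_
    have := W₀.2.2
    exact ⟨⟨W₀.1.map V.subtype, Submodule.map_subtype_le _ _, inferInstance⟩,
      fun W hW => Submodule.map_le_iff_le_comap.1 hW⟩
  refine h.map (Φ := id) continuousAt_id tendsto_m (Eventually.of_forall fun W => ?_)
  rintro z ⟨v, hv, hzv, hz⟩
  exact ⟨v, hv, hzv, fun w hw => hz ⟨w, W.2.1 hw⟩ hw⟩

variable [FiniteDimensional ℝ B]

variable (A Q) in
/-- The linear map `w ↦ (A w, Q(w, κ ·))`. If `κ ∘ A` is a projection, a vector `(ξ, A v)` of the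
Lagrange plane over a space that contains the range of `κ` has `(A v, -ξ ∘ A ∘ κ)` as the value
of this map at `v`, which is how the limit remembers `Q(v, κ ·)`. -/
def augmentedMap (κ : B →ₗ[ℝ] X) : X →ₗ[ℝ] B × StrongDual ℝ B :=
  A.prod (LinearMap.toContinuousLinearMap.toLinearMap ∘ₗ κ.dualMap ∘ₗ Q)

variable {κ : B →ₗ[ℝ] X}

@[simp] theorem augmentedMap_fst (w : X) : (augmentedMap A Q κ w).1 = A w := rfl

variable (A Q κ) in
/-- What the passage from `v` to `v - κ (A v)` does to vectors `(ξ, A v)` of Lagrange planes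
over spaces that contain the range of `κ`; see `correction_mem_lagrangePlane`. -/
def correction (z : StrongDual ℝ B × B) :
    StrongDual ℝ (B × StrongDual ℝ B) × (B × StrongDual ℝ B) :=
  (z.1.coprod (NormedSpace.inclusionInDoubleDual ℝ B z.2),
    (z.2, -z.1.comp (LinearMap.toContinuousLinearMap (A ∘ₗ κ))) - augmentedMap A Q κ (κ z.2))

theorem continuous_correction : Continuous (correction A Q κ) := by
  have : Continuous fun z : StrongDual ℝ B × B => augmentedMap A Q κ (κ z.2) :=
    (augmentedMap A Q κ ∘ₗ κ).continuous_of_finiteDimensional.comp continuous_snd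
  have : Continuous fun z : StrongDual ℝ B × B =>
      z.1.coprod (NormedSpace.inclusionInDoubleDual ℝ B z.2) := by
    simp only [← ContinuousLinearMap.comp_fst_add_comp_snd]
    fun_prop
  unfold correction
  fun_prop

theorem correction_mem_lagrangePlane (hQ : Q.IsSymm) (hκ : ∀ x, κ (A (κ x)) = κ x)
    {W : Submodule ℝ X} (hW : W ≤ LinearMap.ker (κ ∘ₗ A)) {z : StrongDual ℝ B × B}
    (hz : z ∈ lagrangePlane A Q (W ⊔ LinearMap.range κ)) :
    correction A Q κ z ∈ lagrangePlane (augmentedMap A Q κ) Q W := by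
  obtain ⟨v, hv, hzv, hz⟩ := hz
  obtain ⟨w₀, hw₀, _, ⟨x, rfl⟩, rfl⟩ := Submodule.mem_sup.1 hv
  have hκz : κ z.2 = κ x := by
    have : κ (A w₀) = 0 := hW hw₀
    rw [hzv, map_add, map_add, this, hκ, zero_add]
  have hΘ : augmentedMap A Q κ (w₀ + κ x) =
      (z.2, -z.1.comp (LinearMap.toContinuousLinearMap (A ∘ₗ κ))) := by
    refine Prod.ext hzv.symm (ContinuousLinearMap.ext fun y => ?_)
    exact eq_neg_of_add_eq_zero_right (hz (κ y) (Submodule.mem_sup_right ⟨y, rfl⟩))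
  refine ⟨w₀, hw₀, ?_, fun w hw => ?_⟩
  · change _ - augmentedMap A Q κ (κ z.2) = _
    rw [hκz, ← hΘ, map_add, add_sub_cancel_right]
  · change z.1 (A w) + Q w (κ z.2) + Q w₀ w = 0
    have := hz w (Submodule.mem_sup_left hw)
    rw [map_add, LinearMap.add_apply] at this
    rw [hκz, hQ.eq w]
    linarith

theorem isLimitVector_augmentedMap (hQ : Q.IsSymm) (hκ : ∀ x, κ (A (κ x)) = κ x)
    {z : StrongDual ℝ B × B} (hz : IsLimitVector (lagrangeNet A Q ⊤) atTop z) :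
    IsLimitVector (lagrangeNet (augmentedMap A Q κ ∘ₗ (LinearMap.ker (κ ∘ₗ A)).subtype)
      (Q.restrict (LinearMap.ker (κ ∘ₗ A))) ⊤) atTop (correction A Q κ z) := by
  set V := LinearMap.ker (κ ∘ₗ A)
  let m : FinDimSub (⊤ : Submodule ℝ V) → FinDimSub (⊤ : Submodule ℝ X) := fun W =>
    ⟨W.1.map V.subtype ⊔ LinearMap.range κ, le_top,
      have := W.2.2
      inferInstance⟩
  have sub_mem : ∀ v, v - κ (A v) ∈ V := fun v => by simp [V, hκ]
  have tendsto_m : Tendsto m atTop atTop := by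
    refine tendsto_atTop_atTop.2 fun W₀ => ?_
    have := W₀.2.2
    refine ⟨⟨W₀.1.map ((LinearMap.id - κ ∘ₗ A).codRestrict V sub_mem), le_top, inferInstance⟩,
      fun W hW v hv => ?_⟩
    rw [← sub_add_cancel v (κ (A v))]
    exact add_mem (Submodule.mem_sup_left ⟨_, hW (Submodule.mem_map_of_mem hv), rfl⟩)
      (Submodule.mem_sup_right ⟨_, rfl⟩)
  refine hz.map continuous_correction.continuousAt tendsto_m (Eventually.of_forall fun W y hy => ?_)
  obtain ⟨_, ⟨r, hr, rfl⟩, hyr, hy⟩ :=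
    correction_mem_lagrangePlane hQ hκ (Submodule.map_subtype_le V W.1) hy
  exact ⟨r, hr, hyr, fun w hw => hy w (Submodule.mem_map_of_mem hw)⟩

end Net

/-! ### Quadratic forms of finite index -/

section Index

variable {V : Type*} [AddCommGroup V] [Module ℝ V]

/-- `N` is finite-dimensional and `Q` is negative definite on `N`. -/
def IsNegDefOn (Q : LinearMap.BilinForm ℝ V) (N : Submodule ℝ V) : Prop :=
  FiniteDimensional ℝ N ∧ ∀ v ∈ N, v ≠ 0 → Q v v < 0

/-- The negative index of `Q` is infinite: `Q` is negative definite on subspaces of arbitrarily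
large finite dimension. -/
def HasInfiniteIndex (Q : LinearMap.BilinForm ℝ V) : Prop :=
  ∀ n : ℕ, ∃ N, IsNegDefOn Q N ∧ n < finrank ℝ N

variable {Q : LinearMap.BilinForm ℝ V} {N : Submodule ℝ V}

theorem IsNegDefOn.apply_self_nonpos (hN : IsNegDefOn Q N) {v : V} (hv : v ∈ N) : Q v v ≤ 0 := by
  by_cases h0 : v = 0
  · simp [h0]
  · exact (hN.2 v hv h0).le

theorem IsNegDefOn.eq_zero_of_apply_self (hN : IsNegDefOn Q N) {v : V} (hv : v ∈ N)
    (h : Q v v = 0) : v = 0 :=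
  by_contra fun h0 => (hN.2 v hv h0).ne h

theorem IsNegDefOn.nondegenerate_restrict (hN : IsNegDefOn Q N) : (Q.restrict N).Nondegenerate :=
  ⟨fun n hn => Subtype.ext (hN.eq_zero_of_apply_self n.2 (hn n)),
    fun n hn => Subtype.ext (hN.eq_zero_of_apply_self n.2 (hn n))⟩

theorem IsNegDefOn.sup_span_singleton (hQ : Q.IsSymm) (hN : IsNegDefOn Q N) {v : V}
    (hv : v ∈ Q.orthogonal N) (hneg : Q v v < 0) : IsNegDefOn Q (N ⊔ ℝ ∙ v) := by
  have := hN.1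
  refine ⟨inferInstance, fun x hx hx0 => ?_⟩
  obtain ⟨n, hn, _, hy, rfl⟩ := Submodule.mem_sup.1 hx
  obtain ⟨c, rfl⟩ := Submodule.mem_span_singleton.1 hy
  have hnv : Q n v = 0 := hv n hn
  have expand : Q (n + c • v) (n + c • v) = Q n n + c ^ 2 * Q v v := by
    simp only [map_add, map_smul, LinearMap.add_apply, LinearMap.smul_apply, smul_eq_mul,
      hQ.eq v n, hnv]
    ring
  rw [expand]
  by_cases hn0 : n = 0
  · have hc : c ≠ 0 := by
      rintro rfl
      simp [hn0] at hx0
    simp only [hn0, map_zero, zero_add]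
    exact mul_neg_of_pos_of_neg (by positivity) hneg
  · have := hN.2 n hn hn0
    nlinarith [sq_nonneg c]

theorem exists_maximal_isNegDefOn (hQ : Q.IsSymm) (h : ¬HasInfiniteIndex Q) :
    ∃ N, IsNegDefOn Q N ∧ ∀ v ∈ Q.orthogonal N, 0 ≤ Q v v := by
  simp only [HasInfiniteIndex, not_forall, not_exists, not_and, not_lt] at h
  obtain ⟨n, hn⟩ := h
  have bddAbove : BddAbove {m | ∃ N, IsNegDefOn Q N ∧ finrank ℝ N = m} :=
    ⟨n, by rintro _ ⟨N, hN, rfl⟩; exact hn N hN⟩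
  have nonempty : {m | ∃ N, IsNegDefOn Q N ∧ finrank ℝ N = m}.Nonempty :=
    ⟨_, ⊥, ⟨inferInstance, fun v hv h0 => absurd ((Submodule.mem_bot ℝ).1 hv) h0⟩, rfl⟩
  obtain ⟨N, hN, hNm⟩ := Nat.sSup_mem nonempty bddAbove
  refine ⟨N, hN, fun v hv => le_of_not_gt fun hneg => ?_⟩
  have hvN : v ∉ N := fun hvN => hneg.ne (hv v hvN)
  have hsup := hN.sup_span_singleton hQ hv hneg
  have := hsup.1
  have hlt : finrank ℝ N < finrank ℝ (N ⊔ ℝ ∙ v : Submodule ℝ V) :=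
    Submodule.finrank_lt_finrank_of_lt (left_lt_sup.2 fun h =>
      hvN (h (Submodule.mem_span_singleton_self v)))
  exact hlt.not_ge ((le_csSup bddAbove ⟨_, hsup, rfl⟩).trans_eq hNm.symm)

theorem HasInfiniteIndex.exists_mem_ker (h : HasInfiniteIndex Q) {F : Type*} [AddCommGroup F]
    [Module ℝ F] [FiniteDimensional ℝ F] (Θ : V →ₗ[ℝ] F) : ∃ z, Θ z = 0 ∧ Q z z < 0 := by
  obtain ⟨N, hN, hlt⟩ := h (finrank ℝ F)
  have := hN.1
  obtain ⟨z, hz, hz0⟩ := Submodule.exists_mem_ne_zero_of_ne_bot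
    (LinearMap.ker_ne_bot_of_finrank_lt (f := Θ ∘ₗ N.subtype) hlt)
  exact ⟨z, hz, hN.2 z z.2 fun h0 => hz0 (Subtype.ext h0)⟩

theorem exists_orthogonal_projection [FiniteDimensional ℝ N] (hN : (Q.restrict N).Nondegenerate) :
    ∃ P : V →ₗ[ℝ] V, (∀ v, P v ∈ N) ∧ (∀ n ∈ N, P n = n) ∧ ∀ v, ∀ n ∈ N, Q (P v) n = Q v n := by
  let e : N ≃ₗ[ℝ] Dual ℝ N := LinearMap.BilinForm.toDual (Q.restrict N) hN
  let P : V →ₗ[ℝ] N := e.symm.toLinearMap ∘ₗ N.subtype.dualMap ∘ₗ Q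
  have apply_P : ∀ v (n : N), Q (P v) n = Q v n := fun v n =>
    LinearMap.BilinForm.apply_toDual_symm_apply (hB := hN) (Q v ∘ₗ N.subtype) n
  have P_eq : ∀ n : N, P n = n := fun n => e.injective (LinearMap.ext (apply_P n))
  exact ⟨N.subtype ∘ₗ P, fun v => (P v).2, fun n hn => congrArg Subtype.val (P_eq ⟨n, hn⟩),
    fun v n hn => apply_P v ⟨n, hn⟩⟩

theorem exists_seminorm_sq_eq {G : LinearMap.BilinForm ℝ V} (hG : G.IsSymm)
    (hpos : ∀ v, 0 ≤ G v v) :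
    ∃ g : Seminorm ℝ V, (∀ v, g v ^ 2 = G v v) ∧ ∀ v w, |G v w| ≤ g v * g w := by
  let core : PreInnerProductSpace.Core ℝ V :=
    { inner := fun v w => G v w
      conj_inner_symm := fun v w => hG.eq w v
      re_inner_nonneg := hpos
      add_left := fun v v' w => by rw [map_add, LinearMap.add_apply]
      smul_left := fun v w c => by rw [map_smul]; rfl }
  let := InnerProductSpace.Core.toSeminormedAddCommGroup (c := core)
  let : InnerProductSpace ℝ V := InnerProductSpace.ofCore core
  exact ⟨normSeminorm ℝ V, fun v => (real_inner_self_eq_norm_sq v).symm, abs_real_inner_le_norm⟩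

theorem exists_norm_le_of_definite [FiniteDimensional ℝ V] {g : Seminorm ℝ V}
    (hg : ∀ v, g v = 0 → v = 0) {F : Type*} [NormedAddCommGroup F] [NormedSpace ℝ F]
    (Φ : V →ₗ[ℝ] F) : ∃ C, 0 ≤ C ∧ ∀ v, ‖Φ v‖ ≤ C * g v := by
  let : Norm V := ⟨g⟩
  have core : NormedSpace.Core ℝ V :=
    { norm_nonneg := apply_nonneg g
      norm_smul := map_smul_eq_mul g
      norm_triangle := map_add_le_add g
      norm_eq_zero_iff := fun v => ⟨hg v, fun h => h ▸ map_zero g⟩ }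
  let := NormedAddCommGroup.ofCore core
  let := NormedSpace.ofCore core
  exact ⟨‖LinearMap.toContinuousLinearMap Φ‖, norm_nonneg _,
    (LinearMap.toContinuousLinearMap Φ).le_opNorm⟩

/-- `g` is the seminorm of a Hilbert space structure that turns `Q` or `-Q` into the difference of
the squares of the seminorms of two orthogonal components, the negative one being the range of the
projection `P`, which is finite-dimensional; `v ↦ v - 2 P v` is the fundamental symmetry of
indefinite inner product spaces. The absolute value treats `Q` and `-Q` alike. -/
structure IsKreinMajorant (Q : LinearMap.BilinForm ℝ V) (g : Seminorm ℝ V) (P : V →ₗ[ℝ] V) :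
    Prop where
  finiteDimensional_range : FiniteDimensional ℝ (LinearMap.range P)
  abs_apply_le : ∀ v w, |Q v w| ≤ g v * g w
  sq_le : ∀ v, g v ^ 2 ≤ |Q v (v - (2 : ℝ) • P v)|
  proj_le : ∀ v, g (P v) ≤ g v
  definite : ∀ v, g (P v) = 0 → P v = 0

theorem IsKreinMajorant.of_neg {g : Seminorm ℝ V} {P : V →ₗ[ℝ] V}
    (h : IsKreinMajorant (-Q) g P) : IsKreinMajorant Q g P where
  finiteDimensional_range := h.finiteDimensional_range
  abs_apply_le v w := by simpa using h.abs_apply_le v w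
  sq_le v := by simpa only [LinearMap.neg_apply, abs_neg] using h.sq_le v
  proj_le := h.proj_le
  definite := h.definite

theorem IsKreinMajorant.exists_norm_proj_le {g : Seminorm ℝ V} {P : V →ₗ[ℝ] V}
    (h : IsKreinMajorant Q g P) {F : Type*} [NormedAddCommGroup F] [NormedSpace ℝ F]
    (Φ : V →ₗ[ℝ] F) : ∃ C, 0 ≤ C ∧ ∀ v, ‖Φ (P v)‖ ≤ C * g v := by
  have := h.finiteDimensional_range
  obtain ⟨C, hC, hΦ⟩ := exists_norm_le_of_definite (g := g.comp (LinearMap.range P).subtype)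
    (by rintro ⟨_, v, rfl⟩ hv; exact Subtype.ext (h.definite v hv))
    (Φ ∘ₗ (LinearMap.range P).subtype)
  exact ⟨C, hC, fun v => (hΦ ⟨P v, v, rfl⟩).trans (mul_le_mul_of_nonneg_left (h.proj_le v) hC)⟩

theorem exists_seminorm_of_orthogonal_projection (hQ : Q.IsSymm) {P : V →ₗ[ℝ] V}
    (proj_proj : ∀ v, P (P v) = P v) (apply_proj : ∀ v w, Q v (P w) = Q (P v) (P w))
    (proj_nonpos : ∀ v, Q (P v) (P v) ≤ 0) (sub_nonneg : ∀ v, 0 ≤ Q (v - P v) (v - P v)) :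
    ∃ g : Seminorm ℝ V, (∀ v, g v ^ 2 = Q (v - P v) (v - P v) - Q (P v) (P v)) ∧
      ∀ v w, |Q v w| ≤ g v * g w := by
  let G : LinearMap.BilinForm ℝ V := Q.compl₂ (LinearMap.id - (2 : ℝ) • P)
  have G_apply : ∀ v w, G v w = Q v w - 2 * Q (P v) (P w) := fun v w => by
    rw [← apply_proj]
    simp [G]
  have hG : G.IsSymm := ⟨fun v w => by
    rw [G_apply, G_apply, hQ.eq v, hQ.eq (P v)]⟩
  have G_self : ∀ v, G v v = Q (v - P v) (v - P v) - Q (P v) (P v) := fun v => by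
    simp only [G_apply, map_sub, LinearMap.sub_apply, apply_proj v, hQ.eq (P v) v]
    ring
  obtain ⟨g, hg, hgG⟩ := exists_seminorm_sq_eq hG fun v => by
    rw [G_self]
    linarith [sub_nonneg v, proj_nonpos v]
  have G_reflect : ∀ v w, G v (w - (2 : ℝ) • P w) = Q v w := fun v w => by
    simp only [G_apply, map_sub, map_smul, smul_eq_mul, proj_proj, apply_proj v]
    ring
  have g_reflect : ∀ w, g (w - (2 : ℝ) • P w) = g w := fun w => by
    rw [← sq_eq_sq₀ (apply_nonneg g _) (apply_nonneg g _), hg, hg, G_reflect, ← hQ.eq]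
    rfl
  refine ⟨g, fun v => (hg v).trans (G_self v), fun v w => ?_⟩
  rw [← G_reflect, ← g_reflect w]
  exact hgG _ _

theorem exists_isKreinMajorant (hQ : Q.IsSymm) (hN : IsNegDefOn Q N)
    (hmax : ∀ v ∈ Q.orthogonal N, 0 ≤ Q v v) : ∃ g P, IsKreinMajorant Q g P := by
  have := hN.1
  obtain ⟨P, hPN, hP_id, hP⟩ := exists_orthogonal_projection hN.nondegenerate_restrict
  have proj_proj : ∀ v, P (P v) = P v := fun v => hP_id _ (hPN v)
  have apply_proj : ∀ v w, Q v (P w) = Q (P v) (P w) := fun v w => (hP v _ (hPN w)).symm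
  have sub_nonneg : ∀ v, 0 ≤ Q (v - P v) (v - P v) := fun v => hmax _ fun n hn => by
    rw [hQ.eq, map_sub, LinearMap.sub_apply, hP v n hn, sub_self]
  obtain ⟨g, hg, hQg⟩ := exists_seminorm_of_orthogonal_projection hQ proj_proj apply_proj
    (fun v => hN.apply_self_nonpos (hPN v)) sub_nonneg
  have g_proj_sq : ∀ v, g (P v) ^ 2 = -Q (P v) (P v) := fun v => by
    simp [hg, proj_proj]
  have range_le : LinearMap.range P ≤ N := by
    rintro _ ⟨v, rfl⟩
    exact hPN v
  refine ⟨g, P, Submodule.finiteDimensional_of_le range_le, hQg,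
    fun v => ?_, fun v => ?_, fun v hv => ?_⟩
  · have : g v ^ 2 = Q v (v - (2 : ℝ) • P v) := by
      simp only [hg, map_sub, map_smul, LinearMap.sub_apply, smul_eq_mul, apply_proj v,
        hQ.eq (P v) v]
      ring
    exact this.trans_le (le_abs_self _)
  · rw [← sq_le_sq₀ (apply_nonneg g _) (apply_nonneg g _), g_proj_sq, hg]
    linarith [sub_nonneg v]
  · refine hN.eq_zero_of_apply_self (hPN v) ?_
    rw [← neg_eq_zero, ← g_proj_sq, hv, zero_pow two_ne_zero]

theorem exists_isKreinMajorant_or_hasInfiniteIndex (hQ : Q.IsSymm) :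
    (∃ g P, IsKreinMajorant Q g P) ∨ HasInfiniteIndex Q ∧ HasInfiniteIndex (-Q) := by
  by_cases h : HasInfiniteIndex Q
  · by_cases h' : HasInfiniteIndex (-Q)
    · exact Or.inr ⟨h, h'⟩
    · have hQ' : (-Q).IsSymm := ⟨fun v w => congrArg Neg.neg (hQ.eq v w)⟩
      obtain ⟨N, hN, hmax⟩ := exists_maximal_isNegDefOn hQ' h'
      obtain ⟨g, P, hP⟩ := exists_isKreinMajorant hQ' hN hmax
      exact Or.inl ⟨g, P, hP.of_neg⟩
  · obtain ⟨N, hN, hmax⟩ := exists_maximal_isNegDefOn hQ h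
    exact Or.inl (exists_isKreinMajorant hQ hN hmax)

end Index

/-! ### Lagrange planes of forms of finite index -/

section FiniteIndex

theorem le_mul_of_sq_le {x a b t : ℝ} (ht : 0 ≤ t) (ha : 0 ≤ a) (hb : 0 ≤ b)
    (h : x ^ 2 ≤ t * (a * t + b * x)) : x ≤ (a + b + 1) * t := by
  by_contra! hlt
  have htx : t ≤ x := by nlinarith [mul_nonneg (add_nonneg ha hb) ht]
  have hx : 0 < x := lt_of_le_of_lt (by positivity) hlt
  have hle : t * (a * t + b * x) ≤ t * ((a + b) * x) :=
    mul_le_mul_of_nonneg_left (by linarith [mul_le_mul_of_nonneg_left htx ha]) ht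
  have hxx : (a + b + 1) * t * x < x * x := mul_lt_mul_of_pos_right hlt hx
  nlinarith [mul_nonneg ht hx.le]

variable {V : Type*} [AddCommGroup V] [Module ℝ V]
variable {B : Type*} [NormedAddCommGroup B] [NormedSpace ℝ B]

/-- `z = (ξ, x)` is approximated by vectors `(ξ, A r)` with `ξ ∘ A + Q(r, ·)` small with respect
to `g`. As `g` does not see finite-dimensional subspaces, this is stable under enlarging them. -/
def IsApproxLagrangeVector (A : V →ₗ[ℝ] B) (Q : LinearMap.BilinForm ℝ V) (g : Seminorm ℝ V)
    (z : StrongDual ℝ B × B) : Prop :=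
  ∀ ε > 0, ∃ r, ‖z.2 - A r‖ ≤ ε ∧ ∀ w, |z.1 (A w) + Q r w| ≤ ε * g w

variable {A : V →ₗ[ℝ] B} {Q : LinearMap.BilinForm ℝ V} {g : Seminorm ℝ V}

theorem IsApproxLagrangeVector.of_norm_le {z : StrongDual ℝ B × B}
    (h : IsApproxLagrangeVector A Q g z) {B' : Type*} [NormedAddCommGroup B'] [NormedSpace ℝ B']
    {A' : V →ₗ[ℝ] B'} {z' : StrongDual ℝ B' × B'} (h₁ : ∀ w, z'.1 (A' w) = z.1 (A w))
    (h₂ : ∀ w, ‖z'.2 - A' w‖ ≤ ‖z.2 - A w‖) : IsApproxLagrangeVector A' Q g z' := by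
  intro ε hε
  obtain ⟨r, hr, hw⟩ := h ε hε
  exact ⟨r, (h₂ r).trans hr, fun w => h₁ w ▸ hw w⟩

variable {P : V →ₗ[ℝ] V}

theorem IsKreinMajorant.sub_le_mul (h : IsKreinMajorant Q g P) (hQ : Q.IsSymm) {C M s : ℝ}
    (hC : 0 ≤ C) (hCA : ∀ v, ‖A (P v)‖ ≤ C * g v) (hs : 0 ≤ s) (hs₁ : s ≤ 1)
    {W W' : Submodule ℝ V} (hWW' : W ≤ W') (hPW : ∀ v, P v ∈ W)
    {z z' : StrongDual ℝ B × B} {r r' : V} (hr : r ∈ W) (hr' : r' ∈ W') (hzr : z.2 = A r)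
    (hzr' : z'.2 = A r') (hz : ∀ w ∈ W, z.1 (A w) + Q r w = 0)
    (hz' : ∀ w ∈ W', z'.1 (A w) + Q r' w = 0) (hM : ‖z‖ ≤ M) (hM' : ‖z'‖ ≤ M)
    (hzz' : ‖z' - z‖ ≤ s ^ 2) :
    g (r' - r) ≤ (2 * M + 2 * C + 1) * s := by
  set d := r' - r
  have hd : d ∈ W' := sub_mem hr' (hWW' hr)
  have hM₀ : 0 ≤ M := (norm_nonneg _).trans hM
  have hdz : A d = (z' - z).2 := by rw [map_sub, Prod.snd_sub, hzr, hzr']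
  have Q_self : Q d d = -z'.1 (A d) + (z' - z).1 (A r) := by
    have h₁ := hz' d hd
    have h₂ := hz r hr
    have h₃ := hz' r (hWW' hr)
    simp only [d, map_sub, LinearMap.sub_apply, Prod.fst_sub, sub_apply, hQ.eq r r'] at h₁ ⊢
    linarith
  have Q_proj : Q d (P d) = -(z' - z).1 (A (P d)) := by
    have h₁ := hz _ (hPW d)
    have h₂ := hz' _ (hWW' (hPW d))
    rw [LinearMap.map_sub₂, Prod.fst_sub, sub_apply]
    linarith
  have bound_self : |z'.1 (A d)| ≤ M * s ^ 2 :=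
    z'.1.le_of_opNorm_le_of_le ((norm_fst_le _).trans hM') (hdz ▸ (norm_snd_le _).trans hzz')
  have bound_r : |(z' - z).1 (A r)| ≤ s ^ 2 * M :=
    (z' - z).1.le_of_opNorm_le_of_le ((norm_fst_le _).trans hzz')
      (hzr ▸ (norm_snd_le _).trans hM)
  have bound_proj : |(z' - z).1 (A (P d))| ≤ s ^ 2 * (C * g d) :=
    (z' - z).1.le_of_opNorm_le_of_le ((norm_fst_le _).trans hzz') (hCA d)
  have hs₂ : s ^ 2 * (C * g d) ≤ s * (C * g d) :=
    mul_le_mul_of_nonneg_right (by nlinarith) (mul_nonneg hC (apply_nonneg g d))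
  refine le_mul_of_sq_le hs (by positivity) (by positivity) ((h.sq_le d).trans ?_)
  rw [map_sub, map_smul, smul_eq_mul, Q_self, Q_proj]
  rw [abs_le] at *
  constructor <;> linarith

theorem IsLimitVector.exists_seminorm_sub_le (h : IsKreinMajorant Q g P) (hQ : Q.IsSymm)
    {z : StrongDual ℝ B × B} (hz : IsLimitVector (lagrangeNet A Q ⊤) atTop z) {ε : ℝ}
    (hε : 0 < ε) : ∃ r, ‖z.2 - A r‖ ≤ ε ∧ ∀ δ > 0, ∀ᶠ W : FinDimSub (⊤ : Submodule ℝ V) in atTop,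
      ∃ z' r', ‖z - z'‖ ≤ δ ∧ g (r' - r) ≤ ε ∧ ∀ w ∈ W.1, z'.1 (A w) + Q r' w = 0 := by
  obtain ⟨C, hC, hCA⟩ := h.exists_norm_proj_le A
  have := h.finiteDimensional_range
  set K := 2 * (‖z‖ + 1) + 2 * C + 1
  have hK₀ : 0 < K := by positivity
  obtain ⟨s, hs, hs₁, hsε, hKs⟩ : ∃ s : ℝ, 0 < s ∧ s ≤ 1 ∧ s ≤ ε ∧ K * s ≤ ε :=
    ⟨min 1 (min ε (ε / K)), by positivity, min_le_left _ _,
      (min_le_right _ _).trans (min_le_left _ _),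
      (le_div_iff₀' hK₀).1 ((min_le_right _ _).trans (min_le_right _ _))⟩
  have hs₂ : s ^ 2 ≤ s := by nlinarith
  have norm_le : ∀ z', ‖z - z'‖ ≤ s ^ 2 / 2 → ‖z'‖ ≤ ‖z‖ + 1 := fun z' hz' => by
    linarith [norm_le_norm_add_norm_sub z z']
  have hnear := isLimitVector_iff_norm_sub_le.1 hz
  let W₀ : FinDimSub (⊤ : Submodule ℝ V) := ⟨LinearMap.range P, le_top, inferInstance⟩
  obtain ⟨W, ⟨z₁, ⟨r, hr, hzr, hz₁⟩, hzz₁⟩, hW⟩ :=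
    ((hnear (s ^ 2 / 2) (by positivity)).and (eventually_ge_atTop W₀)).exists
  refine ⟨r, hzr ▸ (norm_snd_le (z - z₁)).trans (by linarith), fun δ hδ => ?_⟩
  filter_upwards [hnear (min (s ^ 2 / 2) δ) (by positivity), eventually_ge_atTop W]
    with W' ⟨z', ⟨r', hr', hzr', hz'⟩, hzz'⟩ hWW'
  have hzz'₁ := hzz'.trans (min_le_left _ _)
  refine ⟨z', r', hzz'.trans (min_le_right _ _), ?_, hz'⟩
  refine (h.sub_le_mul hQ hC hCA hs.le hs₁ hWW' (fun v => hW ⟨v, rfl⟩) hr hr' hzr hzr' hz₁ hz'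
    (norm_le _ hzz₁) (norm_le _ hzz'₁) ?_).trans hKs
  linarith [norm_sub_le_norm_sub_add_norm_sub z' z z₁, norm_sub_rev z z']

theorem IsLimitVector.isApproxLagrangeVector (h : IsKreinMajorant Q g P) (hQ : Q.IsSymm)
    {z : StrongDual ℝ B × B} (hz : IsLimitVector (lagrangeNet A Q ⊤) atTop z) :
    IsApproxLagrangeVector A Q g z := by
  intro ε hε
  obtain ⟨r, hzr, hr⟩ := hz.exists_seminorm_sub_le h hQ hε
  refine ⟨r, hzr, fun w => le_of_forall_pos_le_add fun δ hδ => ?_⟩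
  let Ww : FinDimSub (⊤ : Submodule ℝ V) := ⟨ℝ ∙ w, le_top, inferInstance⟩
  obtain ⟨W, ⟨z', r', hzz', g_le, hz'⟩, hwW⟩ :=
    ((hr (δ / (‖A w‖ + 1)) (by positivity)).and (eventually_ge_atTop Ww)).exists
  have hδw : δ / (‖A w‖ + 1) * ‖A w‖ ≤ δ := by
    rw [div_mul_eq_mul_div, div_le_iff₀ (by positivity)]
    linarith
  calc |z.1 (A w) + Q r w|
      = |(z - z').1 (A w) - Q (r' - r) w| := by
        congr 1
        rw [LinearMap.map_sub₂, Prod.fst_sub, sub_apply]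
        linarith [hz' w (hwW (Submodule.mem_span_singleton_self w))]
    _ ≤ |(z - z').1 (A w)| + |Q (r' - r) w| := abs_sub _ _
    _ ≤ δ + ε * g w := add_le_add
        (((z - z').1.le_of_opNorm_le ((norm_fst_le _).trans hzz') _).trans hδw)
        ((h.abs_apply_le _ _).trans (mul_le_mul_of_nonneg_right g_le (apply_nonneg g w)))
    _ = ε * g w + δ := add_comm _ _

theorem IsKreinMajorant.le_mul_norm_of_mem_lagrangePlane (h : IsKreinMajorant Q g P) {C : ℝ}
    (hC : 0 ≤ C) (hCA : ∀ v, ‖A (P v)‖ ≤ C * g v) {W : Submodule ℝ V} (hPW : ∀ v, P v ∈ W)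
    {z : StrongDual ℝ B × B} {v : V} (hv : v ∈ W) (hzv : z.2 = A v)
    (hz : ∀ w ∈ W, z.1 (A w) + Q v w = 0) : g v ≤ (2 * C + 2) * ‖z‖ := by
  have bound_self : |z.1 (A v)| ≤ ‖z‖ * ‖z‖ :=
    z.1.le_of_opNorm_le_of_le (norm_fst_le z) (hzv ▸ norm_snd_le z)
  have bound_proj : |z.1 (A (P v))| ≤ ‖z‖ * (C * g v) :=
    z.1.le_of_opNorm_le_of_le (norm_fst_le z) (hCA v)
  have sq_le : g v ^ 2 ≤ ‖z‖ * (1 * ‖z‖ + 2 * C * g v) := by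
    refine (h.sq_le v).trans ?_
    rw [map_sub, map_smul, smul_eq_mul, eq_neg_of_add_eq_zero_right (hz v hv),
      eq_neg_of_add_eq_zero_right (hz _ (hPW v))]
    rw [abs_le] at *
    constructor <;> linarith
  linarith [le_mul_of_sq_le (norm_nonneg z) zero_le_one (by positivity) sq_le]

theorem IsApproxLagrangeVector.isLimitVector [FiniteDimensional ℝ B] (h : IsKreinMajorant Q g P)
    (hQ : Q.IsSymm) {z : StrongDual ℝ B × B} (hz : IsApproxLagrangeVector A Q g z) :
    IsLimitVector (lagrangeNet A Q ⊤) atTop z := by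
  obtain ⟨C, hC, hCA⟩ := h.exists_norm_proj_le A
  have := h.finiteDimensional_range
  refine isLimitVector_iff_norm_sub_le.2 fun ε hε => ?_
  obtain ⟨r, hzr, hr⟩ := hz (ε / (2 * C + 3)) (by positivity)
  let W₀ : FinDimSub (⊤ : Submodule ℝ V) := ⟨LinearMap.range P ⊔ ℝ ∙ r, le_top, inferInstance⟩
  filter_upwards [eventually_ge_atTop W₀] with W hW
  have hPW : ∀ v, P v ∈ W.1 := fun v => hW (Submodule.mem_sup_left ⟨v, rfl⟩)
  have hrW : r ∈ W.1 := hW (Submodule.mem_sup_right (Submodule.mem_span_singleton_self r))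
  have := W.2.2
  refine exists_near_of_abs_sympForm_le (orthogonal_lagrangePlane_le hQ W.1) hε.le ?_
  rintro z' ⟨v, hv, hz'v, hz'⟩
  have g_le := h.le_mul_norm_of_mem_lagrangePlane hC hCA hPW hv hz'v hz'
  have sympForm_eq : sympForm B z' z = z'.1 (z.2 - A r) - (z.1 (A v) + Q r v) := by
    rw [sympForm_apply, hz'v, map_sub, hQ.eq r v]
    linarith [hz' r hrW]
  calc |sympForm B z' z|
      ≤ |z'.1 (z.2 - A r)| + |z.1 (A v) + Q r v| := sympForm_eq ▸ abs_sub _ _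
    _ ≤ ‖z'‖ * (ε / (2 * C + 3)) + ε / (2 * C + 3) * ((2 * C + 2) * ‖z'‖) :=
        add_le_add (z'.1.le_of_opNorm_le_of_le (norm_fst_le z') hzr)
          ((hr v).trans (mul_le_mul_of_nonneg_left g_le (by positivity)))
    _ = ε * ‖z'‖ := by
        field_simp
        ring

end FiniteIndex

/-! ### Lagrange planes of forms of infinite index -/

section InfiniteIndex

variable {X : Type*} [AddCommGroup X] [Module ℝ X] {Q : LinearMap.BilinForm ℝ X}

theorem HasInfiniteIndex.of_restrict {V : Submodule ℝ X} (h : HasInfiniteIndex (Q.restrict V)) :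
    HasInfiniteIndex Q := by
  intro n
  obtain ⟨N, ⟨hNf, hN⟩, hn⟩ := h n
  refine ⟨N.map V.subtype, ⟨inferInstance, ?_⟩, ?_⟩
  · rintro _ ⟨v, hv, rfl⟩ hv0
    exact hN v hv fun h0 => hv0 (by rw [h0, map_zero])
  · rwa [Submodule.finrank_map_subtype_eq]

theorem HasInfiniteIndex.exists_mem_ker_apply_self_eq (h : HasInfiniteIndex Q) {F : Type*}
    [AddCommGroup F] [Module ℝ F] [FiniteDimensional ℝ F] (Θ : X →ₗ[ℝ] F) {c : ℝ} (hc : c ≤ 0) :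
    ∃ z, Θ z = 0 ∧ Q z z = c := by
  obtain ⟨z, hz, hneg⟩ := h.exists_mem_ker Θ
  refine ⟨√(c / Q z z) • z, by rw [map_smul, hz, smul_zero], ?_⟩
  rw [map_smul, map_smul, LinearMap.smul_apply, smul_smul, smul_eq_mul,
    Real.mul_self_sqrt (div_nonneg_of_nonpos hc hneg.le), div_mul_cancel₀ _ hneg.ne]

theorem exists_mem_ker_apply_self_eq (h : HasInfiniteIndex Q) (h' : HasInfiniteIndex (-Q))
    {F : Type*} [AddCommGroup F] [Module ℝ F] [FiniteDimensional ℝ F] (Θ : X →ₗ[ℝ] F) (c : ℝ) :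
    ∃ z, Θ z = 0 ∧ Q z z = c := by
  rcases le_total c 0 with hc | hc
  · exact h.exists_mem_ker_apply_self_eq Θ hc
  · obtain ⟨z, hz, hzz⟩ := h'.exists_mem_ker_apply_self_eq Θ (neg_nonpos.2 hc)
    exact ⟨z, hz, neg_inj.1 hzz⟩

theorem exists_mem_forall_apply_eq (Q : LinearMap.BilinForm ℝ X) (U K : Submodule ℝ X)
    [FiniteDimensional ℝ U] (f : Dual ℝ X) (hf : ∀ w ∈ K, w ∈ Q.orthogonal U → f w = 0) :
    ∃ u ∈ U, ∀ w ∈ K, Q u w = f w := by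
  let T : K →ₗ[ℝ] Dual ℝ U := U.subtype.dualMap ∘ₗ LinearMap.flip Q ∘ₗ K.subtype
  obtain ⟨φ, hφ⟩ := exists_dual_comp_eq T (f ∘ₗ K.subtype) fun w hw =>
    hf w w.2 fun u hu => LinearMap.congr_fun hw ⟨u, hu⟩
  refine ⟨(evalEquiv ℝ U).symm φ, Subtype.mem _, fun w hw => ?_⟩
  exact (apply_evalEquiv_symm_apply ℝ U (T ⟨w, hw⟩) φ).trans (hφ ⟨w, hw⟩)

theorem exists_le_inf_orthogonal_le (hQ : Q.IsSymm) {U₀ K : Submodule ℝ X}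
    [FiniteDimensional ℝ U₀] (hU₀ : U₀ ≤ K) :
    ∃ U, U₀ ≤ U ∧ U ≤ K ∧ FiniteDimensional ℝ U ∧ U ⊓ Q.orthogonal U ≤ Q.orthogonal K := by
  obtain ⟨U, ⟨hU₀U, hUK, hUf⟩, hmin⟩ := exists_minimalFor_of_wellFoundedLT
    (fun U => U₀ ≤ U ∧ U ≤ K ∧ FiniteDimensional ℝ U)
    (fun U => finrank ℝ (U ⊓ Q.orthogonal U : Submodule ℝ X)) ⟨U₀, le_rfl, hU₀, inferInstance⟩
  refine ⟨U, hU₀U, hUK, hUf, fun k hk w hw => by_contra fun hwk => ?_⟩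
  change ¬Q w k = 0 at hwk
  have hwU : w ∈ U ⊔ ℝ ∙ w := Submodule.mem_sup_right (Submodule.mem_span_singleton_self w)
  have inf_lt : (U ⊔ ℝ ∙ w) ⊓ Q.orthogonal (U ⊔ ℝ ∙ w) < U ⊓ Q.orthogonal U := by
    refine SetLike.lt_iff_le_and_exists.2 ⟨?_, k, hk, fun hk' => hwk (hk'.2 w hwU)⟩
    rintro x ⟨hx, hx'⟩
    obtain ⟨u, hu, _, hy, rfl⟩ := Submodule.mem_sup.1 hx
    obtain ⟨c, rfl⟩ := Submodule.mem_span_singleton.1 hy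
    have hc : c = 0 := by
      have hkx : Q k (u + c • w) = 0 := hx' k (Submodule.mem_sup_left hk.1)
      have hku : Q k u = 0 := hQ.eq u k ▸ hk.2 u hu
      rw [map_add, hku, map_smul, hQ.eq k w, zero_add, smul_eq_mul] at hkx
      exact (mul_eq_zero.1 hkx).resolve_right hwk
    subst hc
    rw [zero_smul, add_zero] at *
    exact ⟨hu, fun u' hu' => hx' u' (Submodule.mem_sup_left hu')⟩
  have hwK : U ⊔ ℝ ∙ w ≤ K := sup_le hUK ((Submodule.span_singleton_le_iff_mem w K).2 hw)
  have : FiniteDimensional ℝ (U ⊓ Q.orthogonal U : Submodule ℝ X) :=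
    Submodule.finiteDimensional_of_le inf_le_left
  have hlt := Submodule.finrank_lt_finrank_of_lt inf_lt
  exact hlt.not_ge (hmin ⟨hU₀U.trans le_sup_left, hwK, inferInstance⟩ hlt.le)

variable {B : Type*} [NormedAddCommGroup B] [NormedSpace ℝ B] [FiniteDimensional ℝ B]
variable {A : X →ₗ[ℝ] B}

theorem exists_add_smul_mem_lagrangePlane (hQ : Q.IsSymm) (h : HasInfiniteIndex Q)
    (h' : HasInfiniteIndex (-Q)) {W : Submodule ℝ X} [FiniteDimensional ℝ W] {w : X}
    (hw : A w = 0) {η : StrongDual ℝ B} (hη : ∀ u ∈ W, η (A u) = Q w u)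
    {z : StrongDual ℝ B × B} (hz : z ∈ lagrangePlane A Q W) (a : ℝ) :
    ∃ W', W ≤ W' ∧ FiniteDimensional ℝ W' ∧
      z + a • ((η, 0) : StrongDual ℝ B × B) ∈ lagrangePlane A Q W' := by
  rcases eq_or_ne a 0 with rfl | ha
  · exact ⟨W, le_rfl, inferInstance, by simpa using hz⟩
  obtain ⟨v, hv, hzv, hz⟩ := hz
  obtain ⟨y, hy, hyy⟩ := exists_mem_ker_apply_self_eq h h'
    (A.prod ((W ⊔ ℝ ∙ w).subtype.dualMap ∘ₗ Q)) (η z.2 / a - Q w w)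
  obtain ⟨hAy, hy⟩ := Prod.mk.inj hy
  have hyW : ∀ u ∈ W ⊔ ℝ ∙ w, Q y u = 0 := fun u hu => LinearMap.congr_fun hy ⟨u, hu⟩
  have hyw : Q y w = 0 := hyW w (Submodule.mem_sup_right (Submodule.mem_span_singleton_self w))
  set x := w + y with hx
  have hAx : A x = 0 := by rw [hx, map_add, hw, hAy, add_zero]
  have hxx : a * Q x x = η z.2 := by
    simp only [hx, map_add, LinearMap.add_apply, hQ.eq w y, hyw, hyy]
    field_simp
    ring
  have hxW : ∀ u ∈ W, Q x u = η (A u) := fun u hu => by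
    rw [hη u hu, hx, map_add, LinearMap.add_apply, hyW u (Submodule.mem_sup_left hu), add_zero]
  have hxW' : x ∈ W ⊔ ℝ ∙ x := Submodule.mem_sup_right (Submodule.mem_span_singleton_self x)
  refine ⟨W ⊔ ℝ ∙ x, le_sup_left, inferInstance, v - a • x,
    sub_mem (Submodule.mem_sup_left hv) (Submodule.smul_mem _ _ hxW'), ?_, fun u' hu' => ?_⟩
  · simp [hAx, hzv]
  · obtain ⟨u, hu, _, hc, rfl⟩ := Submodule.mem_sup.1 hu'
    obtain ⟨c, rfl⟩ := Submodule.mem_span_singleton.1 hc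
    have hvx : Q v x = η z.2 := by rw [hQ.eq v x, hxW v hv, hzv]
    simp only [Prod.fst_add, Prod.smul_fst, add_apply, smul_apply, smul_eq_mul, map_add, map_sub,
      map_smul, LinearMap.sub_apply, LinearMap.smul_apply, hAx, hxW u hu, hvx, smul_zero, add_zero]
    linear_combination hz u hu - c * hxx

variable {Λ : Submodule ℝ (StrongDual ℝ B × B)}

theorem eventually_mk_zero_mem_lagrangePlane (hQ : Q.IsSymm) (h : HasInfiniteIndex Q)
    (h' : HasInfiniteIndex (-Q)) (hΛ : Tendsto (lagrangeNet A Q ⊤) atTop (grassmannNhds Λ)) :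
    ∀ᶠ W : FinDimSub (⊤ : Submodule ℝ X) in atTop, ∀ w, A w = 0 → ∀ η : StrongDual ℝ B,
      (∀ u ∈ W.1, η (A u) = Q w u) → (η, (0 : B)) ∈ lagrangePlane A Q W.1 := by
  obtain ⟨ε, hε, finrank_le⟩ := exists_finrank_le_of_infDist_le Λ
  filter_upwards [eventually_finrank_eq_of_tendsto_grassmannNhds hΛ,
    eventually_forall_ge_atTop.2 (eventually_infDist_le_of_tendsto_grassmannNhds hΛ hε)]
    with W hd hnear w hw η hη
  have := W.2.2
  have near_sup : ∀ y ∈ lagrangePlane A Q W.1 ⊔ ℝ ∙ (η, (0 : B)),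
      Metric.infDist y Λ ≤ ε * ‖y‖ := fun y hy => by
    obtain ⟨z, hz, _, hc, rfl⟩ := Submodule.mem_sup.1 hy
    obtain ⟨a, rfl⟩ := Submodule.mem_span_singleton.1 hc
    obtain ⟨W', hWW', hW', hmem⟩ := exists_add_smul_mem_lagrangePlane hQ h h' hw hη hz a
    exact hnear ⟨W', le_top, hW'⟩ hWW' _ hmem
  have sup_eq := Submodule.eq_of_le_of_finrank_le le_sup_left
    ((finrank_le _ near_sup).trans_eq hd.symm)
  exact sup_eq.ge (Submodule.mem_sup_right (Submodule.mem_span_singleton_self _))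

theorem eventually_apply_eq_zero (hQ : Q.IsSymm) (h : HasInfiniteIndex Q)
    (h' : HasInfiniteIndex (-Q)) (hΛ : Tendsto (lagrangeNet A Q ⊤) atTop (grassmannNhds Λ)) :
    ∀ᶠ W : FinDimSub (⊤ : Submodule ℝ X) in atTop, ∀ z ∈ lagrangePlane A Q W.1, ∀ v ∈ W.1,
      z.2 = A v → ∀ w ∈ LinearMap.ker A, w ∈ Q.orthogonal (W.1 ⊓ LinearMap.ker A) → Q v w = 0 := by
  filter_upwards [eventually_mk_zero_mem_lagrangePlane hQ h h' hΛ] with W hW z hz v hv hzv w hw hwW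
  obtain ⟨η, hη⟩ := exists_strongDual_comp_eq (A := A) W.1 (Q w) fun u hu hAu => by
    rw [hQ.eq]
    exact hwW u ⟨hu, hAu⟩
  have hsymp : sympForm B (η, 0) z = 0 := lagrangePlane_le_orthogonal hQ W.1 hz _ (hW w hw η hη)
  rw [sympForm_apply, map_zero, sub_zero, hzv, hη v hv] at hsymp
  rw [hQ.eq, hsymp]

theorem frequently_lagrangePlane_le_top (hQ : Q.IsSymm) (h : HasInfiniteIndex Q)
    (h' : HasInfiniteIndex (-Q)) (hΛ : Tendsto (lagrangeNet A Q ⊤) atTop (grassmannNhds Λ)) :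
    ∃ᶠ W : FinDimSub (⊤ : Submodule ℝ X) in atTop,
      lagrangePlane A Q W.1 ≤ lagrangePlane A Q ⊤ := by
  obtain ⟨W₁, hW₁⟩ := eventually_atTop.1 (eventually_apply_eq_zero hQ h h' hΛ)
  obtain ⟨σ, hσ⟩ := A.rangeRestrict.exists_rightInverse_of_surjective A.range_rangeRestrict
  refine frequently_atTop.2 fun W₀ => ?_
  have := W₀.2.2
  have := W₁.2.2
  set W₂ := W₀.1 ⊔ W₁.1 ⊔ LinearMap.range σ
  have : FiniteDimensional ℝ (W₂ ⊓ LinearMap.ker A : Submodule ℝ X) :=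
    Submodule.finiteDimensional_of_le inf_le_left
  obtain ⟨U, hU₂, hUK, hUf, hU⟩ := exists_le_inf_orthogonal_le hQ
    (inf_le_right : W₂ ⊓ LinearMap.ker A ≤ LinearMap.ker A)
  have inf_ker : (W₂ ⊔ U) ⊓ LinearMap.ker A = U := by
    rw [sup_comm, sup_inf_assoc_of_le _ hUK, sup_eq_left.2 hU₂]
  let W : FinDimSub (⊤ : Submodule ℝ X) := ⟨W₂ ⊔ U, le_top, inferInstance⟩
  have hW₂ : W₂ ≤ W.1 := le_sup_left
  refine ⟨W, (le_sup_left.trans le_sup_left).trans hW₂, ?_⟩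
  rintro z ⟨v, hv, hzv, hz⟩
  have apply_U : ∀ u ∈ U, Q v u = 0 := fun u hu => by
    have hu' : A u = 0 := hUK hu
    simpa [hu'] using hz u (Submodule.mem_sup_right hu)
  have apply_ker : ∀ w, A w = 0 → Q v w = 0 := by
    obtain ⟨k, hk, hkv⟩ := exists_mem_forall_apply_eq Q U (LinearMap.ker A) (Q v) fun w hw hwU =>
      hW₁ W ((le_sup_right.trans le_sup_left).trans hW₂) z ⟨v, hv, hzv, hz⟩ v hv hzv w hw
        (inf_ker.symm ▸ hwU)
    have hk' : k ∈ Q.orthogonal U := fun u hu =>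
      (hQ.eq u k).trans ((hkv u (hUK hu)).trans (apply_U u hu))
    exact fun w hw => (hkv w hw).symm.trans ((hQ.eq k w).trans (hU ⟨hk, hk'⟩ w hw))
  refine ⟨v, trivial, hzv, fun w _ => ?_⟩
  set y : X := σ (A.rangeRestrict w)
  have hAy : A y = A w := congrArg Subtype.val (LinearMap.congr_fun hσ (A.rangeRestrict w))
  have hy := hz y (hW₂ (Submodule.mem_sup_right ⟨_, rfl⟩))
  have hwy := apply_ker (w - y) (by rw [map_sub, hAy, sub_self])
  rw [map_sub] at hwy
  rw [hAy] at hy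
  linarith

theorem le_lagrangePlane_top_of_tendsto (hQ : Q.IsSymm) (h : HasInfiniteIndex Q)
    (h' : HasInfiniteIndex (-Q)) (hΛ : Tendsto (lagrangeNet A Q ⊤) atTop (grassmannNhds Λ)) :
    Λ ≤ lagrangePlane A Q ⊤ := fun _ hz =>
  (isLimitVector_of_tendsto_grassmannNhds hΛ hz).mem_of_frequently_le
    (Submodule.closed_of_finiteDimensional _) (frequently_lagrangePlane_le_top hQ h h' hΛ)

end InfiniteIndex

/-! ### Reduction of the limit of Lagrange planes -/

section LimitReduction

theorem exists_comp_comp_eq {V W : Type*} [AddCommGroup V] [Module ℝ V] [AddCommGroup W]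
    [Module ℝ W] (f : V →ₗ[ℝ] W) :
    ∃ g : W →ₗ[ℝ] V, f ∘ₗ g ∘ₗ f = f ∧ g ∘ₗ f ∘ₗ g = g := by
  obtain ⟨σ, hσ⟩ := f.rangeRestrict.exists_rightInverse_of_surjective f.range_rangeRestrict
  obtain ⟨ρ, hρ⟩ := (LinearMap.range f).subtype.exists_leftInverse_of_injective
    (LinearMap.range f).ker_subtype
  have hfσ : ∀ y, f (σ y) = y := fun y => congrArg Subtype.val (LinearMap.congr_fun hσ y)
  have hρf : ∀ y : LinearMap.range f, ρ y = y := LinearMap.congr_fun hρ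
  refine ⟨σ ∘ₗ ρ, LinearMap.ext fun v => ?_, LinearMap.ext fun w => ?_⟩
  · change f (σ (ρ (f v))) = f v
    rw [hfσ, hρf ⟨f v, v, rfl⟩]
  · change σ (ρ (f (σ (ρ w)))) = σ (ρ w)
    rw [hfσ, hρf]

variable {X : Type*} [AddCommGroup X] [Module ℝ X] {Q : LinearMap.BilinForm ℝ X}
variable {B : Type*} [NormedAddCommGroup B] [NormedSpace ℝ B]
variable {B' : Type*} [NormedAddCommGroup B'] [NormedSpace ℝ B']
variable {A₀ : X →ₗ[ℝ] B} {A₁ : X →ₗ[ℝ] B'} {S : Submodule ℝ B}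
variable {ξ : StrongDual ℝ B} {ζ : StrongDual ℝ B'} {x : B} {y : B'}

theorem IsKreinMajorant.isLimitVector_lagrangeNet_comap [FiniteDimensional ℝ B]
    [FiniteDimensional ℝ B'] {g : Seminorm ℝ (S.comap A₀)} {P : S.comap A₀ →ₗ[ℝ] S.comap A₀}
    (h : IsKreinMajorant (Q.restrict (S.comap A₀)) g P) (hQ : Q.IsSymm)
    (hξ : ∀ s ∈ S, ξ s = 0) (hx : x ∈ S)
    (hz : IsLimitVector (lagrangeNet (A₀.prod A₁) Q ⊤) atTop (ξ.coprod ζ, (x, y))) :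
    IsLimitVector (lagrangeNet A₁ Q (S.comap A₀)) atTop (ζ, y) := by
  obtain ⟨τ, hτ, hτ'⟩ := exists_comp_comp_eq (S.mkQ ∘ₗ A₀)
  let κ : B × B' →ₗ[ℝ] X := τ ∘ₗ S.mkQ ∘ₗ LinearMap.fst ℝ B B'
  have hκ : ∀ b, κ (A₀.prod A₁ (κ b)) = κ b := fun b => LinearMap.congr_fun hτ' (S.mkQ b.1)
  have hκx : κ (x, y) = 0 := by
    change τ (S.mkQ x) = 0
    rw [Submodule.mkQ_apply, (Submodule.Quotient.mk_eq_zero S).2 hx, map_zero]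
  have ker_eq : LinearMap.ker (κ ∘ₗ A₀.prod A₁) = S.comap A₀ := by
    ext v
    refine Iff.trans ⟨fun hv : τ (S.mkQ (A₀ v)) = 0 => ?_, fun hv => ?_⟩
      (Submodule.Quotient.mk_eq_zero S)
    · exact (LinearMap.congr_fun hτ v).symm.trans ((congrArg (S.mkQ ∘ₗ A₀) hv).trans (map_zero _))
    · exact (congrArg τ hv).trans (map_zero τ)
  have hQV : (Q.restrict (S.comap A₀)).IsSymm := hQ.restrict _
  have hlim := isLimitVector_augmentedMap hQ hκ hz
  rw [ker_eq] at hlim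
  refine isLimitVector_lagrangeNet_of_restrict (IsApproxLagrangeVector.isLimitVector h hQV
    ((hlim.isApproxLagrangeVector h hQV).of_norm_le (fun w => ?_) fun w => ?_))
  · change ζ (A₁ w) = ξ (A₀ w) + ζ (A₁ w) + Q w (κ (x, y))
    rw [hκx, map_zero, add_zero, hξ _ w.2, zero_add]
  · have : y - A₁ w = ((correction (A₀.prod A₁) Q κ (ξ.coprod ζ, (x, y))).2 -
        augmentedMap (A₀.prod A₁) Q κ w).1.2 := by
      simp [correction, hκx]
    exact (congrArg norm this).le.trans ((norm_snd_le _).trans (norm_fst_le _))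

theorem isLimitVector_lagrangeNet_comap_of_mem (hξ : ∀ s ∈ S, ξ s = 0) (hx : x ∈ S)
    (hz : (ξ.coprod ζ, (x, y)) ∈ lagrangePlane (A₀.prod A₁) Q ⊤) :
    IsLimitVector (lagrangeNet A₁ Q (S.comap A₀)) atTop (ζ, y) := by
  obtain ⟨v, -, hv, hvw⟩ := hz
  obtain ⟨hxv, hyv⟩ := Prod.mk.inj hv
  have hvS : v ∈ S.comap A₀ := by
    rwa [Submodule.mem_comap, ← hxv]
  refine isLimitVector_iff_norm_sub_le.2 fun ε hε => ?_
  filter_upwards [eventually_ge_atTop (⟨ℝ ∙ v, (Submodule.span_singleton_le_iff_mem _ _).2 hvS,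
    inferInstance⟩ : FinDimSub (S.comap A₀))] with W hW
  refine ⟨(ζ, y), ⟨v, hW (Submodule.mem_span_singleton_self v), hyv, fun w hw => ?_⟩, ?_⟩
  · have : ξ (A₀ w) + ζ (A₁ w) + Q v w = 0 := hvw w trivial
    rwa [hξ _ (W.2.1 hw), zero_add] at this
  · rw [sub_self, norm_zero]
    exact hε.le

theorem tendsto_lagrangeNet_comap [FiniteDimensional ℝ B] [FiniteDimensional ℝ B']
    (hQ : Q.IsSymm) {Λ : Submodule ℝ (StrongDual ℝ (B × B') × (B × B'))}
    (hΛ : Tendsto (lagrangeNet (A₀.prod A₁) Q ⊤) atTop (grassmannNhds Λ)) :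
    Tendsto (lagrangeNet A₁ Q (S.comap A₀)) atTop (grassmannNhds (reduction S Λ)) := by
  have orthogonal_eq : (sympForm (B × B')).orthogonal Λ = Λ :=
    orthogonal_eq_of_tendsto_grassmannNhds (fun W => by
      have := W.2.2
      exact (orthogonal_lagrangePlane_le hQ W.1).antisymm (lagrangePlane_le_orthogonal hQ W.1)) hΛ
  refine tendsto_grassmannNhds (Eventually.of_forall fun W => ?_) fun z hz => ?_
  · have := W.2.2
    exact (finrank_lagrangePlane hQ W.1).trans_le
      (le_finrank_of_coisotropic (orthogonal_reduction_le S orthogonal_eq.le))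
  · obtain ⟨ξ, x, hx, hξ, hz⟩ := mem_reduction.1 hz
    rcases exists_isKreinMajorant_or_hasInfiniteIndex (hQ.restrict (S.comap A₀)) with
      ⟨g, P, hP⟩ | ⟨h, h'⟩
    · exact hP.isLimitVector_lagrangeNet_comap hQ hξ hx
        (isLimitVector_of_tendsto_grassmannNhds hΛ hz)
    · exact isLimitVector_lagrangeNet_comap_of_mem hξ hx
        (le_lagrangePlane_top_of_tendsto hQ h.of_restrict
          (HasInfiniteIndex.of_restrict (Q := -Q) h') hΛ hz)

end LimitReduction

/-! ### The `𝓛`-derivative of a pair of maps -/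

section Jets

variable {X : Type*} [NormedAddCommGroup X] [NormedSpace ℝ X]
variable {B : Type*} [NormedAddCommGroup B] [NormedSpace ℝ B]
variable {B' : Type*} [NormedAddCommGroup B'] [NormedSpace ℝ B']

theorem secondDiff_comm (g : X → B) (x v w : X) : secondDiff g x v w = secondDiff g x w v := by
  simp only [secondDiff, smul_apply, add_apply, ContinuousLinearMap.flip_apply]
  rw [add_comm]

/-- The second variation `⟨p, d²g⟩ - ν d²j` as a bilinear form. -/
def secondVariationForm (g : X → B) (j : X → ℝ) (x : X) (p : StrongDual ℝ B) (ν : ℝ) :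
    LinearMap.BilinForm ℝ X :=
  LinearMap.mk₂ ℝ (secondVariation (TwoJet.of g j x) p ν)
    (fun a b c => by simp [secondVariation]; ring) (fun c a b => by simp [secondVariation]; ring)
    (fun a b c => by simp [secondVariation]; ring) (fun c a b => by simp [secondVariation]; ring)

theorem secondVariationForm_isSymm (g : X → B) (j : X → ℝ) (x : X) (p : StrongDual ℝ B) (ν : ℝ) :
    (secondVariationForm g j x p ν).IsSymm := ⟨fun v w => by
  change p (secondDiff g x v w) - ν * secondDiff j x v w =
    p (secondDiff g x w v) - ν * secondDiff j x w v
  rw [secondDiff_comm g, secondDiff_comm j]⟩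

theorem lDerivOver_ofPair (g₀ : X → B) (g₁ : X → B') (j : X → ℝ) (x : X) (p₀ : StrongDual ℝ B)
    (p₁ : StrongDual ℝ B') (ν : ℝ) (h : secondDiff g₀ x = 0) (W : Submodule ℝ X) :
    lDerivOver (TwoJet.ofPair g₀ g₁ j x) (p₀.coprod p₁) ν W =
      lagrangePlane ((fderiv ℝ g₀ x : X →ₗ[ℝ] B).prod (fderiv ℝ g₁ x : X →ₗ[ℝ] B'))
        (secondVariationForm g₁ j x p₁ ν) W := by
  have secondVariation_eq : ∀ v w, secondVariation (TwoJet.ofPair g₀ g₁ j x) (p₀.coprod p₁) ν v w =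
      secondVariationForm g₁ j x p₁ ν v w := fun v w => by
    change (p₀.coprod p₁) _ - _ = p₁ (secondDiff g₁ x v w) - ν * secondDiff j x v w
    simp [TwoJet.ofPair, h]
  ext z
  change (∃ v ∈ W, _ ∧ ∀ w ∈ W, _ + secondVariation _ _ ν v w = 0) ↔ _
  simp only [secondVariation_eq]
  rfl

variable {g₀ : X → B} {g₁ : X → B'} {j : X → ℝ} {x : X} {p₀ : StrongDual ℝ B}
variable {p₁ : StrongDual ℝ B'} {ν : ℝ} {S : Submodule ℝ B}

theorem IsLagrangePoint.of_ofPair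
    (h : IsLagrangePoint (TwoJet.ofPair g₀ g₁ j x) (p₀.coprod p₁) ν ⊤) (hp₀ : ∀ s ∈ S, p₀ s = 0) :
    IsLagrangePoint (TwoJet.of g₁ j x) p₁ ν (S.comap (fderiv ℝ g₀ x : X →ₗ[ℝ] B)) := by
  intro w hw
  have pair_eq : p₀ (fderiv ℝ g₀ x w) + p₁ (fderiv ℝ g₁ x w) - ν * fderiv ℝ j x w = 0 :=
    h w trivial
  rwa [hp₀ (fderiv ℝ g₀ x w) hw, zero_add] at pair_eq

theorem IsLDerivative.of_ofPair [FiniteDimensional ℝ B] [FiniteDimensional ℝ B']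
    (h₀ : secondDiff g₀ x = 0) {Λ : Submodule ℝ (StrongDual ℝ (B × B') × (B × B'))}
    (h : IsLDerivative (TwoJet.ofPair g₀ g₁ j x) (p₀.coprod p₁) ν ⊤ Λ) :
    IsLDerivative (TwoJet.of g₁ j x) p₁ ν (S.comap (fderiv ℝ g₀ x : X →ₗ[ℝ] B))
      (reduction S Λ) :=
  tendsto_lagrangeNet_comap (secondVariationForm_isSymm g₁ j x p₁ ν)
    (h.congr fun W => lDerivOver_ofPair g₀ g₁ j x p₀ p₁ ν h₀ W.1)

end Jets

section Control

variable {k : ℕ} {E : Type*} [NormedAddCommGroup E] [NormedSpace ℝ E]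
variable {M : Type*} [TopologicalSpace M] [ChartedSpace E M] [IsManifold 𝓘(ℝ, E) ∞ M]
variable (𝒮 : ControlSystem k E M) (T t₀ : ℝ)

theorem trajectory_self (a : M) (u : Control k T) : 𝒮.trajectory T t₀ a u t₀ = a := by
  unfold ControlSystem.trajectory
  split_ifs with h
  · exact h.choose_spec.2
  · rfl

variable {φ : OpenPartialHomeomorph M E} {x : E}

theorem evalCoord_eventuallyEq_fst (hx : x ∈ φ.target) (u : Control k T) :
    𝒮.evalCoord T t₀ φ φ t₀ =ᶠ[𝓝 (x, u)] Prod.fst := by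
  have hφ : Prod.fst ⁻¹' φ.target ∈ 𝓝 (x, u) :=
    continuous_fst.continuousAt.preimage_mem_nhds (φ.open_target.mem_nhds hx)
  filter_upwards [hφ] with z hz
  rw [ControlSystem.evalCoord, trajectory_self, φ.right_inv hz]

theorem fderiv_evalCoord_eventuallyEq (hx : x ∈ φ.target) (u : Control k T) :
    fderiv ℝ (𝒮.evalCoord T t₀ φ φ t₀) =ᶠ[𝓝 (x, u)]
      fun _ => ContinuousLinearMap.fst ℝ E (Control k T) :=
  (evalCoord_eventuallyEq_fst 𝒮 T t₀ hx u).fderiv.trans (Eventually.of_forall fun _ => fderiv_fst)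

theorem secondDiff_evalCoord (hx : x ∈ φ.target) (u : Control k T) :
    secondDiff (𝒮.evalCoord T t₀ φ φ t₀) (x, u) = 0 := by
  have fderiv_fderiv : fderiv ℝ (fderiv ℝ (𝒮.evalCoord T t₀ φ φ t₀)) (x, u) = 0 :=
    (fderiv_evalCoord_eventuallyEq 𝒮 T t₀ hx u).fderiv_eq.trans (fderiv_const_apply _)
  rw [secondDiff, fderiv_fderiv]
  simp

end Control

end

end LDeriv

theorem mainTheorem11
    {E : Type*} [NormedAddCommGroup E] [NormedSpace ℝ E] [FiniteDimensional ℝ E]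
    {M : Type*} [TopologicalSpace M] [T2Space M] [ChartedSpace E M] [IsManifold 𝓘(ℝ, E) ∞ M]
    {k : ℕ} (𝒮 : LDeriv.ControlSystem k E M)
    (T t₀ t₁ : ℝ) (ht₀ : 0 ≤ t₀) (ht : t₀ < t₁) (ht₁ : t₁ ≤ T)
    (q : ℝ → M) (u : LDeriv.Control k T) (hω : 𝒮.IsAdmissible T q u)
    (N₀ : Set M) (hN₀ : LDeriv.IsEmbeddedSubmanifold (E := E) N₀) (hq : q t₀ ∈ N₀)
    -- canonical coordinates on the cotangent bundle over `q t₀` and `q t₁`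
    (φ₀ : OpenPartialHomeomorph M E) (S : Submodule ℝ E)
    (hφ₀ : LDeriv.IsSliceChart N₀ φ₀ (q t₀) S)
    (φ₁ : OpenPartialHomeomorph M E) (hφ₁ : φ₁ ∈ IsManifold.maximalAtlas 𝓘(ℝ, E) ∞ M)
    (hq₁ : q t₁ ∈ φ₁.source)
    (ν : ℝ) (l₀ : TangentSpace 𝓘(ℝ, E) (q t₀) →L[ℝ] ℝ)
    (l₁ : TangentSpace 𝓘(ℝ, E) (q t₁) →L[ℝ] ℝ)
    (p₀ p₁ : StrongDual ℝ E) (hp₀ : p₀ = LDeriv.covectorCoord φ₀ (q t₀) l₀)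
    (hp₁ : p₁ = LDeriv.covectorCoord φ₁ (q t₁) l₁)
    (hLagrange : LDeriv.IsLagrangePoint (𝒮.twoPointJet T t₀ t₁ φ₀ φ₁ q u)
      ((-p₀).coprod p₁) ν ⊤)
    (hl₀ : ∀ v ∈ LDeriv.sliceTangentSpace φ₀ (q t₀) S, l₀ v = 0) :
    LDeriv.IsLagrangePoint (𝒮.endPointJet T t₀ t₁ φ₀ φ₁ q u) p₁ ν
        (𝒮.startTangentSpace T t₀ φ₀ q u S) ∧
      ∀ Λ : Submodule ℝ (StrongDual ℝ (E × E) × (E × E)),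
        LDeriv.IsLDerivative (𝒮.twoPointJet T t₀ t₁ φ₀ φ₁ q u)
            ((-p₀).coprod p₁) ν ⊤ Λ →
          LDeriv.IsLDerivative (𝒮.endPointJet T t₀ t₁ φ₀ φ₁ q u) p₁ ν
            (𝒮.startTangentSpace T t₀ φ₀ q u S)
            ((Λ ⊓ (LDeriv.annihilatorProd S).comap LDeriv.proj₀).map LDeriv.proj₁) := by
  have hx : φ₀ (q t₀) ∈ φ₀.target := φ₀.map_source hφ₀.mem_source
  refine ⟨hLagrange.of_ofPair fun s hs => ?_,
    fun Λ hΛ => hΛ.of_ofPair (LDeriv.secondDiff_evalCoord 𝒮 T t₀ hx u)⟩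
  rw [hp₀, neg_apply, neg_eq_zero]
  exact hl₀ _ (Submodule.mem_map_of_mem hs)
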